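/- Let $\ell, m, n$ be positive integers and $v=\min\{n,\ell\}$. All manifolds (Hausdorff, second countable, without boundary) and mappings are of class $C^\infty$. Let $N$ be a manifold of dimension $n$, let $f:N\to U$ be an immersion into an open subset $U$ of $\mathbb{R}^m$, and let $F:U\to\mathbb{R}^\ell$ be a mapping. For a linear mapping $\pi\in\mathcal{L}(\mathbb{R}^m,\mathbb{R}^\ell)=(\mathbb{R}^m)^\ell$ put $F_\pi=F+\pi|_U$. Let $J^1(N,\mathbb{R}^\ell)$ be the bundle of $1$-jets of mappings $N\to\mathbb{R}^\ell$; for $g:N\to\mathbb{R}^\ell$ let $j^1g:N\to J^1(N,\mathbb{R}^\ell)$ be its $1$-jet prolongation. Put $\operatorname{corank} dg_q=v-\operatorname{rank} dg_q$, and for $1\le k\le v$ let $\Sigma^k(N,\mathbb{R}^\ell)\subset J^1(N,\mathbb{R}^\ell)$ be the submanifold of all $1$-jets $j^1g(q)$ with $\operatorname{corank} dg_q=k$. A mapping $g:N\to P$ is transverse to a submanifold $W\subset P$ if $dg_q(T_qN)+T_{g(q)}W=T_{g(q)}P$ for every $q\in N$ with $g(q)\in W$. There is a largest integer $k_0$ with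 $(n-v+k_0)(\ell-v+k_0)\le n$, and if $\ell\ge 2$ then $k_0+1\le v$. Moreover, there exists a subset $\Sigma\subset\mathcal{L}(\mathbb{R}^m,\mathbb{R}^\ell)$ of Lebesgue measure zero such that for every $\pi\in\mathcal{L}(\mathbb{R}^m,\mathbb{R}^\ell)\setminus\Sigma$: 1. $j^1(F_\pi\circ f)$ is transverse to $\Sigma^k(N,\mathbb{R}^\ell)$ for every integer $k$ with $1\le k\le v$; 2. if $\ell\ge 2$, then $j^1(F_\pi\circ f)(N)\cap\Sigma^k(N,\mathbb{R}^\ell)=\emptyset$ for every integer $k$ with $k_0+1\le k\le v$; 3. $\operatorname{corank} d(F_\pi\circ f)_q\le k_0$ for every $q\in N$. -/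

import Mathlib

open MeasureTheory
open scoped Manifold ContDiff Topology

/-! ### Tangent spaces of submanifolds and transversality -/

section Transversality

variable {EN HN N EP HP P : Type*}
  [NormedAddCommGroup EN] [NormedSpace ℝ EN] [TopologicalSpace HN]
  [TopologicalSpace N] [ChartedSpace HN N]
  [NormedAddCommGroup EP] [NormedSpace ℝ EP] [TopologicalSpace HP]
  [TopologicalSpace P] [ChartedSpace HP P]

/-- `v ∈ T_p P` is the velocity at time `0` of a germ of a smooth curve `γ : (ℝ, 0) → (P, p)` that
runs inside `W`. -/
def IsVelocityIn (J : ModelWithCorners ℝ EP HP) (W : Set P) (p : P) (v : TangentSpace J p) :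
    Prop :=
  ∃ γ : ℝ → P, γ 0 = p ∧ ContMDiffAt 𝓘(ℝ, ℝ) J ∞ γ 0 ∧ (∀ᶠ t in 𝓝 (0 : ℝ), γ t ∈ W) ∧
    (mfderiv 𝓘(ℝ, ℝ) J γ 0 (1 : ℝ) : EP) = v

/-- The tangent space `T_p W ⊆ T_p P` of a submanifold `W` of `P` at a point `p ∈ W`: the space of
velocities at `p` of smooth curves in `W`. (For a submanifold these velocities already form a
linear subspace, so that taking the span adds nothing.) -/
noncomputable def submanifoldTangentSpace (J : ModelWithCorners ℝ EP HP) (W : Set P) (p : P) :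
    Submodule ℝ (TangentSpace J p) :=
  Submodule.span ℝ {v | IsVelocityIn J W p v}

/-- `g : N → P` is transverse to the submanifold `W` of `P` at `q`: either `g q ∉ W`, or
`dg_q (T_q N) + T_{g q} W = T_{g q} P`. -/
def TransverseAt (I : ModelWithCorners ℝ EN HN) (J : ModelWithCorners ℝ EP HP) (g : N → P)
    (W : Set P) (q : N) : Prop :=
  g q ∉ W ∨
    LinearMap.range (mfderiv I J g q : TangentSpace I q →ₗ[ℝ] TangentSpace J (g q)) ⊔
      submanifoldTangentSpace J W (g q) = ⊤

/-- `g : N → P` is transverse to the submanifold `W` of `P`. -/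
def Transverse (I : ModelWithCorners ℝ EN HN) (J : ModelWithCorners ℝ EP HP) (g : N → P)
    (W : Set P) : Prop :=
  ∀ q, TransverseAt I J g W q

end Transversality

/-! ### The jet bundle `J¹(N, ℝ^ℓ)` and its corank strata -/

section Jets

variable {n : ℕ} (ℓ : ℕ) (N : Type*) [TopologicalSpace N]
  [ChartedSpace (EuclideanSpace ℝ (Fin n)) N] [IsManifold (𝓡 n) ∞ N]

/-- The model fibre `ℝ^ℓ × Hom(ℝⁿ, ℝ^ℓ)` of the jet bundle. -/
abbrev JetModel (n ℓ : ℕ) : Type :=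
  EuclideanSpace ℝ (Fin ℓ) × (EuclideanSpace ℝ (Fin n) →L[ℝ] EuclideanSpace ℝ (Fin ℓ))

/-- The fibre of `J¹(N, ℝ^ℓ)` over `q ∈ N`: the 1-jet at `q` of a map `g : N → ℝ^ℓ` is the pair of
its value `g q` and its differential `dg_q : T_q N → ℝ^ℓ`. -/
abbrev JetFibre (q : N) : Type :=
  Bundle.Trivial N (EuclideanSpace ℝ (Fin ℓ)) q ×
    (TangentSpace (𝓡 n) q →L[ℝ] Bundle.Trivial N (EuclideanSpace ℝ (Fin ℓ)) q)

/-- The space of 1-jets `J¹(N, ℝ^ℓ)`, as the total space of the smooth vector bundle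
`ℝ^ℓ × Hom(TN, ℝ^ℓ)` over `N`. Its charts, the ones of this total space in Mathlib, are
`(q, y, A) ↦ (φ q, y, A ∘ (dφ_q)⁻¹)` for the charts `φ` of `N`. -/
abbrev JetBundle : Type _ :=
  Bundle.TotalSpace (JetModel n ℓ) (JetFibre (n := n) ℓ N)

/-- The model with corners of the manifold `J¹(N, ℝ^ℓ)`. -/
noncomputable abbrev jetModelWithCorners (n ℓ : ℕ) :=
  (𝓡 n).prod 𝓘(ℝ, JetModel n ℓ)

variable {ℓ N}

/-- The 1-jet prolongation `j¹g : N → J¹(N, ℝ^ℓ)`, `q ↦ (q, g q, dg_q)`. -/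
noncomputable def jetProlongation (g : N → EuclideanSpace ℝ (Fin ℓ)) (q : N) : JetBundle (n := n) ℓ N :=
  ⟨q, (g q, mfderiv (𝓡 n) (𝓡 ℓ) g q)⟩

variable (ℓ) in
/-- The corank `min {n, ℓ} - rank A` of a linear map `A : T_q N → ℝ^ℓ`. (The rank is at most
`min {n, ℓ}`.) -/
noncomputable def corank {q : N}
    (A : TangentSpace (𝓡 n) q →L[ℝ] EuclideanSpace ℝ (Fin ℓ)) : ℕ :=
  min n ℓ - Module.finrank ℝ
    (LinearMap.range (A : TangentSpace (𝓡 n) q →ₗ[ℝ] EuclideanSpace ℝ (Fin ℓ)))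

variable (n ℓ N) in
/-- The stratum `Σᵏ(N, ℝ^ℓ)` of the 1-jets of corank `k`. -/
def corankStratum (k : ℕ) : Set (JetBundle (n := n) ℓ N) :=
  {p | corank ℓ (q := p.proj) p.snd.2 = k}

end Jets

/-! ### Subsets of Lebesgue measure zero of the space of linear maps -/

/-- A set `S` of linear maps `ℝᵐ → ℝ^ℓ` has Lebesgue measure zero: under the identification
`π ↦ (π_ij)`, with `π_ij` the `i`-th coordinate of `π e_j`, of the space of linear maps
with `(ℝᵐ)^ℓ`, it becomes a null set of the Lebesgue measure. -/
def HasLebesgueMeasureZero {m ℓ : ℕ}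
    (S : Set (EuclideanSpace ℝ (Fin m) →L[ℝ] EuclideanSpace ℝ (Fin ℓ))) : Prop :=
  volume ((fun (π : EuclideanSpace ℝ (Fin m) →L[ℝ] EuclideanSpace ℝ (Fin ℓ))
    (i : Fin ℓ) (j : Fin m) => π (EuclideanSpace.single j 1) i) '' S) = 0

/-!
# Generic linear perturbations and the corank strata of 1-jets

The proof reduces everything to one condition on a map `G` between Euclidean spaces and a point
`x`, with `A = dG_x`: every linear map `T` has the form `D²G_x v + B ∘ A + A ∘ C`
(`TransverseToRank`). The maps `B ∘ A + A ∘ C` are the velocities at `A` of curves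
`(1 + tB) A (1 + tC)` of linear maps of constant rank, so the condition says that `dG` is transverse
to the linear maps of the rank of `A`. It does not depend on the coordinates
(`TransverseToRank.comp_fderiv`) and implies the transversality of `j¹g` to the corank strata
(`transverseAt_jetProlongation`). Passing to the quotient `Hom (ker A, coker A)`, it also gives
`dim (ker A) * dim (coker A) ≤ n` (`TransverseToRank.mul_le_finrank`), which is the bound on the
corank; the strata of higher corank are therefore not met at all.

The condition holds for almost every `π` (`ae_transverseToRank`). In a chart the differential of
`(F + π) ∘ f` is `P x + π ∘ H x`, with `H x = df_x` injective. Near a point where this map is `A₀`,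
split the source as `range A₀ ⊕ ker A₀` and the target as `range A₀ ⊕ C`. A nearby map has the rank
of `A₀` exactly if its Schur complement in `Hom (ker A₀, C)` vanishes, and the condition follows if
the Schur complement, as a function of `x`, has surjective derivative
(`BlockSplitting.transverseToRank_of_surjective_schurDeriv`). As `H` is injective, `π` can be
moved so as to add to the lower row of the block decomposition an arbitrary `τ : ker A₀ → C`, up to
a factor that is invertible near the point; the Schur complement then becomes `τ - Ψ x` up to an
invertible factor, with `Ψ` independent of `τ`. By Sard's theorem almost every `τ` is a regular
value of `Ψ`, and Fubini's theorem gives a null set of `π`.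

Sard's theorem for smooth maps of arbitrary finite dimensions
(`addHaar_image_not_surjective_eq_zero`) is proved by reduction to real functions: the level sets
of the first component at its regular values are hypersurfaces, on which induction on the dimension
of the target applies. For real functions the critical points are split according to the order of
the first nonvanishing higher derivative: those of order at most the dimension `n` of the source lie
on hypersurfaces (induction on `n`), and on the remaining ones the function is Hölder of exponent
`n + 1`.
-/

/-! ### Sard's theorem -/

theorem measure_image_null_of_locally {E F : Type*} [TopologicalSpace E]
    [SecondCountableTopology E] [MeasurableSpace F] {μ : Measure F} {f : E → F} {Z : Set E}
    (h : ∀ x ∈ Z, ∃ T ∈ 𝓝 x, μ (f '' (Z ∩ T)) = 0) : μ (f '' Z) = 0 := by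
  choose! T hT hμ using h
  obtain ⟨t, htZ, htc, ht⟩ := TopologicalSpace.countable_cover_nhdsWithin
    (fun x hx => mem_nhdsWithin_of_mem_nhds (hT x hx) : ∀ x ∈ Z, T x ∈ 𝓝[Z] x)
  refine measure_mono_null (t := ⋃ x ∈ t, f '' (Z ∩ T x)) ?_
    ((measure_biUnion_null_iff htc).2 fun x hx => hμ x (htZ hx))
  rintro _ ⟨x, hx, rfl⟩
  obtain ⟨y, hy, hxy⟩ := Set.mem_iUnion₂.1 (ht hx)
  exact Set.mem_iUnion₂.2 ⟨y, hy, x, ⟨hx, hxy⟩, rfl⟩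

/-- Near a regular point `x₀` of a smooth function `h`, the level set `{h = h x₀}` is parametrized
by an open subset of the tangent hyperplane `ker dh_{x₀}`. -/
theorem exists_levelSet_parametrization {E : Type*} [NormedAddCommGroup E] [NormedSpace ℝ E]
    [FiniteDimensional ℝ E] {U : Set E} (hU : IsOpen U) {h : E → ℝ} (hh : ContDiffOn ℝ ∞ h U)
    {x₀ : E} (hx₀ : x₀ ∈ U) (hd : fderiv ℝ h x₀ ≠ 0) :
    ∃ (V : Set (fderiv ℝ h x₀).ker) (φ : (fderiv ℝ h x₀).ker → E), IsOpen V ∧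
      ContDiffOn ℝ ∞ φ V ∧ Set.MapsTo φ V U ∧ (∀ y ∈ V, h (φ y) = h x₀) ∧
      ∃ T ∈ 𝓝 x₀, ∀ x ∈ T, h x = h x₀ → ∃ y ∈ V, φ y = x := by
  set L := fderiv ℝ h x₀ with hL
  have : CompleteSpace E := FiniteDimensional.complete ℝ E
  obtain ⟨P, hP⟩ := Submodule.ClosedComplemented.of_finiteDimensional L.ker
  obtain ⟨u, hu⟩ : ∃ u, L u = 1 := by
    obtain ⟨w, hw⟩ : ∃ w, L w ≠ 0 := by
      by_contra! H
      exact hd (ContinuousLinearMap.ext H)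
    exact ⟨(L w)⁻¹ • w, by simp [hw]⟩
  have hbij : Function.Bijective (L.prod P) := by
    constructor
    · rw [injective_iff_map_eq_zero]
      intro x hx
      have h1 : L x = 0 := congrArg Prod.fst hx
      have h2 : P x = 0 := congrArg Prod.snd hx
      have h3 := hP ⟨x, h1⟩
      rw [h2] at h3
      exact (congrArg Subtype.val h3).symm
    · rintro ⟨s, k⟩
      refine ⟨s • u + (k - P (s • u) : L.ker), ?_⟩
      have hk : L ((k - P (s • u) : L.ker) : E) = 0 := (k - P (s • u) : L.ker).2
      refine Prod.ext ?_ ?_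
      · simp only [ContinuousLinearMap.prod_apply, map_add, map_smul, hu]; simp
      · simp only [ContinuousLinearMap.prod_apply, map_add, hP]; simp
  set Φ : E → ℝ × L.ker := fun x => (h x, P x) with hΦ
  have hΦs : ContDiffOn ℝ ∞ Φ U := hh.prodMk P.contDiff.contDiffOn
  have hΦd : ∀ x ∈ U, HasFDerivAt Φ ((fderiv ℝ h x).prod P) x := fun x hx =>
    (((hh.contDiffAt (hU.mem_nhds hx)).differentiableAt (by simp)).hasFDerivAt).prodMk
      P.hasFDerivAt
  let e₀ : E ≃L[ℝ] ℝ × L.ker := ContinuousLinearEquiv.ofBijective (L.prod P)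
    (LinearMap.ker_eq_bot.2 hbij.1) (LinearMap.range_eq_top.2 hbij.2)
  have he₀ : (e₀ : E →L[ℝ] ℝ × L.ker) = L.prod P := by ext1 x; rfl
  have hΦ₀ : HasFDerivAt Φ (e₀ : E →L[ℝ] ℝ × L.ker) x₀ := by
    rw [he₀]; exact hΦd x₀ hx₀
  let e := (hΦs.contDiffAt (hU.mem_nhds hx₀)).toOpenPartialHomeomorph Φ hΦ₀ (by simp)
  have hex₀ : x₀ ∈ e.source :=
    (hΦs.contDiffAt (hU.mem_nhds hx₀)).mem_toOpenPartialHomeomorph_source hΦ₀ (by simp)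
  have hcont : ContinuousOn (fun x => (fderiv ℝ h x).prod P) U :=
    (ContinuousLinearMap.prodₗᵢ ℝ).continuous.comp_continuousOn
      ((hh.continuousOn_fderiv_of_isOpen hU (by simp)).prodMk continuousOn_const)
  let O : Set E := U ∩ (fun x => (fderiv ℝ h x).prod P) ⁻¹'
    Set.range ((↑) : (E ≃L[ℝ] ℝ × L.ker) → (E →L[ℝ] ℝ × L.ker))
  have hO : IsOpen O := hcont.isOpen_inter_preimage hU ContinuousLinearEquiv.isOpen
  have hx₀O : x₀ ∈ O := ⟨hx₀, e₀, he₀⟩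
  let e' := e.restrOpen O hO
  have hsrc : e'.source = e.source ∩ O := e.restrOpen_source O hO
  have hcoe : ∀ x, e' x = Φ x := fun x => rfl
  have hsymm : ∀ y ∈ e'.target, e'.symm y ∈ U ∧ ContDiffAt ℝ ∞ e'.symm y ∧
      Φ (e'.symm y) = y := by
    intro y hy
    have hm := e'.map_target hy
    rw [hsrc] at hm
    obtain ⟨hmU, e₁, he₁⟩ := hm.2
    refine ⟨hmU, e'.contDiffAt_symm hy (f₀' := e₁) ?_ ?_, e'.right_inv hy⟩
    · rw [he₁]; exact hΦd _ hmU
    · exact hΦs.contDiffAt (hU.mem_nhds hmU)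
  refine ⟨(fun y => (h x₀, y)) ⁻¹' e'.target, fun y => e'.symm (h x₀, y),
    e'.open_target.preimage (by fun_prop), ?_, fun y hy => (hsymm _ hy).1, ?_,
    e'.source, e'.open_source.mem_nhds (hsrc ▸ ⟨hex₀, hx₀O⟩), ?_⟩
  · intro y hy
    exact ((hsymm _ hy).2.1.comp y (by fun_prop)).contDiffWithinAt
  · intro y hy
    exact congrArg Prod.fst (hsymm _ hy).2.2
  · intro x hx hxx
    have h1 : e' x = (h x₀, P x) := by rw [hcoe, ← hxx]
    refine ⟨P x, ?_, ?_⟩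
    · change (h x₀, P x) ∈ e'.target
      rw [← h1]; exact e'.map_source hx
    · change e'.symm (h x₀, P x) = x
      rw [← h1]; exact e'.left_inv hx

/-- The critical values of `f` coming from points where its derivatives of orders `1, …, n` all
vanish, `n` being the dimension of the source, form a null set: on the set of these points `f` is
Hölder of exponent `n + 1`, so that its image has Hausdorff dimension at most `n / (n + 1) < 1`. -/
theorem volume_image_flat_eq_zero {E : Type*} [NormedAddCommGroup E] [NormedSpace ℝ E]
    [FiniteDimensional ℝ E] {U : Set E} (hU : IsOpen U) {f : E → ℝ} (hf : ContDiffOn ℝ ∞ f U) :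
    volume (f '' {x ∈ U | ∀ j, 1 ≤ j → j ≤ Module.finrank ℝ E → iteratedFDeriv ℝ j f x = 0}) =
      0 := by
  borelize E
  set n := Module.finrank ℝ E
  set Z := {x ∈ U | ∀ j, 1 ≤ j → j ≤ n → iteratedFDeriv ℝ j f x = 0}
  have hdim : dimH (f '' Z) ≤ dimH Z / ((n + 1 : ℕ) : NNReal) := by
    refine dimH_image_le_of_locally_holder_on (by positivity) fun x₀ hx₀ => ?_
    have hsm : ∀ x ∈ U, ∀ j : ℕ, ContDiffAt ℝ ∞ (iteratedFDeriv ℝ j f) x := fun x hx j =>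
      (hf.contDiffAt (hU.mem_nhds hx)).iteratedFDeriv_right (mod_cast le_top)
    obtain ⟨C, hC⟩ : ∃ C : NNReal, ∀ᶠ x in 𝓝 x₀, ‖iteratedFDeriv ℝ (n + 1) f x‖ ≤ C := by
      refine ⟨‖iteratedFDeriv ℝ (n + 1) f x₀‖₊ + 1, ?_⟩
      refine ((hsm x₀ hx₀.1 (n + 1)).continuousAt.norm.eventually_lt_const
        (lt_add_one _)).mono fun x hx => ?_
      simpa using hx.le
    obtain ⟨r, hr, hball⟩ := Metric.eventually_nhds_iff_ball.1
      (hC.and (hU.eventually_mem hx₀.1))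
    refine ⟨C, Z ∩ Metric.ball x₀ r,
      inter_mem_nhdsWithin _ (Metric.ball_mem_nhds x₀ hr), ?_⟩
    have key : ∀ x ∈ Z ∩ Metric.ball x₀ r, ∀ i : ℕ, i ≤ n → ∀ y ∈ Metric.ball x₀ r,
        ‖iteratedFDeriv ℝ (n - i) f y - iteratedFDeriv ℝ (n - i) f x‖ ≤ C * ‖y - x‖ ^ (i + 1) := by
      intro x hx i
      induction i with
      | zero =>
        intro _ y hy
        rw [zero_add, pow_one]
        refine (convex_ball x₀ r).norm_image_sub_le_of_norm_fderiv_le (𝕜 := ℝ)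
          (fun z hz => (hsm z (hball z hz).2 _).differentiableAt (by simp)) (fun z hz => ?_) hx.2 hy
        rw [norm_fderiv_iteratedFDeriv]
        exact (hball z hz).1
      | succ i ih =>
        intro hi y hy
        have hs : segment ℝ x y ⊆ Metric.ball x₀ r := (convex_ball x₀ r).segment_subset hx.2 hy
        have hstep := (convex_segment x y).norm_image_sub_le_of_norm_fderiv_le (𝕜 := ℝ)
          (f := iteratedFDeriv ℝ (n - (i + 1)) f) (C := C * ‖y - x‖ ^ (i + 1))
          (fun z hz => (hsm z (hball z (hs hz)).2 _).differentiableAt (by simp)) (fun z hz => ?_)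
          (left_mem_segment ℝ x y) (right_mem_segment ℝ x y)
        · calc _ ≤ _ := hstep
            _ = _ := by ring
        · rw [norm_fderiv_iteratedFDeriv, show n - (i + 1) + 1 = n - i by omega]
          have h1 := ih (by omega) z (hs hz)
          rw [hx.1.2 (n - i) (by omega) (by omega), sub_zero] at h1
          refine h1.trans ?_
          gcongr
          exact norm_sub_le_of_mem_segment hz
    intro x hx y hy
    have h1 := key y hy n le_rfl x hx.2
    rw [Nat.sub_self] at h1
    have h2 : ‖iteratedFDeriv ℝ 0 f x - iteratedFDeriv ℝ 0 f y‖ = ‖f x - f y‖ := by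
      rw [iteratedFDeriv_zero_eq_comp, Function.comp_apply, Function.comp_apply, ← map_sub,
        LinearIsometryEquiv.norm_map]
    rw [h2] at h1
    rw [edist_eq_enorm_sub, edist_eq_enorm_sub]
    have h3 : ‖f x - f y‖₊ ≤ C * ‖x - y‖₊ ^ (n + 1) := by exact_mod_cast h1
    rw [NNReal.coe_natCast, ENNReal.rpow_natCast, enorm_eq_nnnorm, enorm_eq_nnnorm]
    exact_mod_cast h3
  have hlt : dimH (f '' Z) < 1 := by
    have h1 : dimH Z ≤ n := by
      rw [← Real.dimH_univ_eq_finrank E]; exact dimH_mono (Set.subset_univ _)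
    refine (hdim.trans (ENNReal.div_le_div_right h1 _)).trans_lt ?_
    rw [ENNReal.div_lt_iff (by simp) (by simp)]
    simp only [one_mul]
    norm_cast
    exact Nat.lt_succ_self n
  have h0 := hausdorffMeasure_of_dimH_lt (d := 1) (by simpa using hlt)
  rwa [NNReal.coe_one, hausdorffMeasure_real] at h0

/-- **Sard's theorem for real functions**: the set of critical values of a smooth real function on
an open subset of a finite-dimensional space is null. -/
theorem volume_image_fderiv_eq_zero (n : ℕ) : ∀ {E : Type*} [NormedAddCommGroup E]
    [NormedSpace ℝ E] [FiniteDimensional ℝ E], Module.finrank ℝ E = n → ∀ {U : Set E},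
    IsOpen U → ∀ {f : E → ℝ}, ContDiffOn ℝ ∞ f U →
    volume (f '' {x ∈ U | fderiv ℝ f x = 0}) = 0 := by
  induction n using Nat.strong_induction_on with
  | _ n IH =>
  intro E _ _ _ hn U hU f hf
  let Z : ℕ → Set E := fun i =>
    {x ∈ U | fderiv ℝ f x = 0 ∧ ∀ j, 1 ≤ j → j ≤ i → iteratedFDeriv ℝ j f x = 0}
  have hsm : ∀ x ∈ U, ∀ j : ℕ, ContDiffAt ℝ ∞ (iteratedFDeriv ℝ j f) x := fun x hx j =>
    (hf.contDiffAt (hU.mem_nhds hx)).iteratedFDeriv_right (mod_cast le_top)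
  -- Points where the derivatives up to order `i` vanish, but not the one of order `i + 1`, lie on
  -- the regular hypersurface where a component of the derivative of order `i` vanishes.
  have hstep : ∀ i, volume (f '' (Z i \ Z (i + 1))) = 0 := by
    intro i
    refine measure_image_null_of_locally fun x₀ hx₀ => ?_
    obtain ⟨⟨hx₀U, hcrit, hvan⟩, hnot⟩ := hx₀
    have hne : iteratedFDeriv ℝ (i + 1) f x₀ ≠ 0 := by
      intro h0
      refine hnot ⟨hx₀U, hcrit, fun j h1 h2 => ?_⟩
      rcases Nat.lt_or_ge i j with h | h
      · obtain rfl : j = i + 1 := by omega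
        exact h0
      · exact hvan j h1 h
    have hi : 1 ≤ i := by
      rcases Nat.eq_zero_or_pos i with rfl | h
      · exfalso
        apply hne
        rw [← norm_eq_zero, zero_add, norm_iteratedFDeriv_one, hcrit, norm_zero]
      · exact h
    obtain ⟨m, hm⟩ : ∃ m, iteratedFDeriv ℝ (i + 1) f x₀ m ≠ 0 := by
      by_contra! H
      exact hne (ContinuousMultilinearMap.ext H)
    set v := Fin.tail m
    set h : E → ℝ := fun x => iteratedFDeriv ℝ i f x v
    have hh : ContDiffOn ℝ ∞ h U := fun x hx =>
      ((ContinuousMultilinearMap.apply ℝ (fun _ : Fin i => E) ℝ v).contDiff.contDiffAt.comp x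
        (hsm x hx i)).contDiffWithinAt
    have hd : fderiv ℝ h x₀ ≠ 0 := by
      intro h0
      have h1 : HasFDerivAt h ((ContinuousMultilinearMap.apply ℝ (fun _ : Fin i => E) ℝ v).comp
          (fderiv ℝ (iteratedFDeriv ℝ i f) x₀)) x₀ :=
        (ContinuousMultilinearMap.apply ℝ (fun _ : Fin i => E) ℝ v).hasFDerivAt.comp x₀
          ((hsm x₀ hx₀U i).differentiableAt (by simp)).hasFDerivAt
      apply hm
      rw [iteratedFDeriv_succ_apply_left]
      have h2 := h1.fderiv
      rw [h0] at h2
      exact (congrArg (fun A : E →L[ℝ] ℝ => A (m 0)) h2).symm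
    obtain ⟨V, φ, hV, hφ, hVU, hφh, T, hT, hTφ⟩ := exists_levelSet_parametrization hU hh hx₀U hd
    refine ⟨T, hT, ?_⟩
    have hlt : Module.finrank ℝ (fderiv ℝ h x₀).ker < n := by
      have := Module.Dual.finrank_ker_add_one_of_ne_zero
        (f := ((fderiv ℝ h x₀ : E →L[ℝ] ℝ) : E →ₗ[ℝ] ℝ))
        (fun h0 => hd (ContinuousLinearMap.coe_injective h0))
      omega
    refine measure_mono_null ?_ (IH _ hlt rfl hV (hf.comp hφ hVU))
    rintro _ ⟨x, ⟨hx, hxT⟩, rfl⟩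
    have hzero : ∀ x ∈ Z i, h x = 0 := fun x hx => by
      simp only [h, hx.2.2 i hi le_rfl, _root_.zero_apply]
    obtain ⟨y, hy, rfl⟩ := hTφ x hxT
      (by rw [hzero x hx.1, hzero x₀ ⟨hx₀U, hcrit, hvan⟩])
    refine ⟨y, ⟨hy, ?_⟩, rfl⟩
    rw [fderiv_comp _ ((hf.contDiffAt (hU.mem_nhds hx.1.1)).differentiableAt (by simp))
      ((hφ.contDiffAt (hV.mem_nhds hy)).differentiableAt (by simp)), hx.1.2.1]
    simp
  have hall : ∀ k, k ≤ n → volume (f '' Z (n - k)) = 0 := by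
    intro k
    induction k with
    | zero =>
      intro _
      refine measure_mono_null (Set.image_mono ?_) (volume_image_flat_eq_zero hU hf)
      intro x hx
      exact ⟨hx.1, fun j h1 h2 => hx.2.2 j h1 (by omega)⟩
    | succ k ih =>
      intro hk
      refine measure_mono_null ?_
        (measure_union_null (hstep (n - (k + 1))) (ih (by omega)))
      rw [show n - k = n - (k + 1) + 1 by omega, ← Set.image_union]
      refine Set.image_mono fun x hx => ?_
      by_cases h : x ∈ Z (n - (k + 1) + 1)
      · exact Or.inr h
      · exact Or.inl ⟨hx, h⟩
  refine measure_mono_null (Set.image_mono ?_) (hall n le_rfl)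
  intro x hx
  exact ⟨hx.1, hx.2, fun j h1 h2 => by omega⟩

theorem isOpen_setOf_surjective_clm {E F : Type*} [NormedAddCommGroup E] [NormedSpace ℝ E]
    [NormedAddCommGroup F] [NormedSpace ℝ F] [FiniteDimensional ℝ F] :
    IsOpen {A : E →L[ℝ] F | Function.Surjective A} := by
  have : CompleteSpace F := FiniteDimensional.complete ℝ F
  have heq : {A : E →L[ℝ] F | Function.Surjective A} =
      ⋃ B : F →L[ℝ] E, (fun A : E →L[ℝ] F => A.comp B) ⁻¹' {u | IsUnit u} := by
    ext A
    simp only [Set.mem_ofPred_eq, Set.mem_iUnion, Set.mem_preimage]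
    constructor
    · intro hA
      obtain ⟨B, hB⟩ := (A : E →ₗ[ℝ] F).exists_rightInverse_of_surjective
        (LinearMap.range_eq_top.2 hA)
      refine ⟨B.toContinuousLinearMap, ?_⟩
      have : A.comp B.toContinuousLinearMap = 1 := by
        ext x; exact congrArg (fun C : F →ₗ[ℝ] F => C x) hB
      rw [this]; exact isUnit_one
    · rintro ⟨B, u, hu⟩ y
      refine ⟨B ((↑u⁻¹ : F →L[ℝ] F) y), ?_⟩
      have : (A.comp B) * (↑u⁻¹ : F →L[ℝ] F) = 1 := by rw [← hu]; exact u.mul_inv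
      exact congrArg (fun C : F →L[ℝ] F => C y) this
  rw [heq]
  exact isOpen_iUnion fun B => Units.isOpen.preimage
    ((ContinuousLinearMap.compL ℝ F E F).flip B).continuous

/-- **Sard's theorem** for maps to `ℝᶜ`. The induction on `c` disintegrates over the values of the
first component, the level sets of which are smooth hypersurfaces for almost every value. -/
theorem volume_image_not_surjective_eq_zero (c : ℕ) : ∀ {E : Type*} [NormedAddCommGroup E]
    [NormedSpace ℝ E] [FiniteDimensional ℝ E] {U : Set E},
    IsOpen U → ∀ {f : E → (Fin c → ℝ)}, ContDiffOn ℝ ∞ f U →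
    volume (f '' {x ∈ U | ¬ Function.Surjective (fderiv ℝ f x)}) = 0 := by
  induction c with
  | zero =>
    intro E _ _ _ U hU f hf
    have : {x ∈ U | ¬ Function.Surjective (fderiv ℝ f x)} = ∅ := by
      ext x
      simp only [Set.mem_ofPred_eq, Set.mem_empty_iff_false, iff_false, not_and, not_not]
      exact fun _ y => ⟨0, Subsingleton.elim _ _⟩
    rw [this, Set.image_empty, measure_empty]
  | succ c IH =>
    intro E _ _ _ U hU f hf
    have hfd : ∀ x ∈ U, DifferentiableAt ℝ f x := fun x hx =>
      (hf.contDiffAt (hU.mem_nhds hx)).differentiableAt (by simp)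
    set f₁ : E → ℝ := fun x => f x 0 with hf₁def
    set f₂ : E → (Fin c → ℝ) := fun x i => f x i.succ with hf₂def
    have hf₁ : ContDiffOn ℝ ∞ f₁ U := fun x hx => contDiffWithinAt_pi.1 (hf x hx) 0
    have hf₂ : ContDiffOn ℝ ∞ f₂ U := fun x hx =>
      contDiffWithinAt_pi.2 fun i => contDiffWithinAt_pi.1 (hf x hx) i.succ
    have hd₁ : ∀ x ∈ U, ∀ v, fderiv ℝ f₁ x v = fderiv ℝ f x v 0 := by
      intro x hx v
      rw [((hasFDerivAt_pi'.1 (hfd x hx).hasFDerivAt) 0).fderiv]; rfl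
    have hd₂ : ∀ x ∈ U, ∀ v i, fderiv ℝ f₂ x v i = fderiv ℝ f x v i.succ := by
      intro x hx v i
      have h1 : HasFDerivAt f₂ (ContinuousLinearMap.pi fun i : Fin c =>
          (ContinuousLinearMap.proj i.succ).comp (fderiv ℝ f x)) x :=
        hasFDerivAt_pi.2 fun i => (hasFDerivAt_pi'.1 (hfd x hx).hasFDerivAt) i.succ
      rw [h1.fderiv]; rfl
    -- Compact pieces of the critical set have compact, hence measurable images, as Fubini's
    -- theorem requires.
    refine measure_image_null_of_locally fun x₀ hx₀ => ?_
    obtain ⟨r, hr, hball⟩ := Metric.nhds_basis_closedBall.mem_iff.1 (hU.mem_nhds hx₀.1)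
    refine ⟨Metric.closedBall x₀ r, Metric.closedBall_mem_nhds x₀ hr, ?_⟩
    set K := {x ∈ U | ¬ Function.Surjective (fderiv ℝ f x)} ∩ Metric.closedBall x₀ r with hK
    have hKc : IsCompact K := by
      have : K = Metric.closedBall x₀ r ∩
          (fderiv ℝ f) ⁻¹' {A : E →L[ℝ] (Fin (c + 1) → ℝ) | Function.Surjective A}ᶜ := by
        ext x
        constructor
        · exact fun hx => ⟨hx.2, hx.1.2⟩
        · exact fun hx => ⟨⟨hball hx.1, hx.2⟩, hx.1⟩
      rw [this]
      refine (isCompact_closedBall x₀ r).of_isClosed_subset ?_ Set.inter_subset_left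
      have hcont := (hf.continuousOn_fderiv_of_isOpen hU (by simp)).mono hball
      exact hcont.preimage_isClosed_of_isClosed
        Metric.isClosed_closedBall isOpen_setOf_surjective_clm.isClosed_compl
    have hKU : K ⊆ U := fun x hx => hx.1.1
    let e := MeasurableEquiv.piFinSuccAbove (fun _ : Fin (c + 1) => ℝ) 0
    have he : MeasurePreserving e volume volume :=
      volume_preserving_piFinSuccAbove (fun _ : Fin (c + 1) => ℝ) 0
    have himg : f '' K = e ⁻¹' ((fun x => (f₁ x, f₂ x)) '' K) := by
      ext y
      constructor
      · rintro ⟨x, hx, rfl⟩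
        exact ⟨x, hx, rfl⟩
      · rintro ⟨x, hx, hxy⟩
        exact ⟨x, hx, e.injective hxy⟩
    have hmeas : MeasurableSet ((fun x => (f₁ x, f₂ x)) '' K) :=
      (hKc.image_of_continuousOn
        ((hf₁.continuousOn.prodMk hf₂.continuousOn).mono hKU)).measurableSet
    rw [himg, he.measure_preimage hmeas.nullMeasurableSet, Measure.volume_eq_prod,
      Measure.measure_prod_null hmeas]
    have hreg : ∀ᵐ a : ℝ, a ∉ f₁ '' {x ∈ U | fderiv ℝ f₁ x = 0} :=
      measure_eq_zero_iff_ae_notMem.1 (volume_image_fderiv_eq_zero _ rfl hU hf₁)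
    filter_upwards [hreg] with a ha
    have hsub : Prod.mk a ⁻¹' ((fun x => (f₁ x, f₂ x)) '' K) ⊆ f₂ '' {x ∈ K | f₁ x = a} := by
      rintro b ⟨x, hx, hxb⟩
      exact ⟨x, ⟨hx, congrArg Prod.fst hxb⟩, congrArg Prod.snd hxb⟩
    refine measure_mono_null hsub (measure_image_null_of_locally fun x₁ hx₁ => ?_)
    have hx₁U := hKU hx₁.1
    have hd : fderiv ℝ f₁ x₁ ≠ 0 := fun h0 => ha ⟨x₁, ⟨hx₁U, h0⟩, hx₁.2⟩
    obtain ⟨V, φ, hV, hφ, hVU, hφh, T, hT, hTφ⟩ := exists_levelSet_parametrization hU hf₁ hx₁U hd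
    refine ⟨T, hT, measure_mono_null ?_ (IH hV (hf₂.comp hφ hVU))⟩
    rintro _ ⟨x, ⟨⟨hxK, hxa⟩, hxT⟩, rfl⟩
    obtain ⟨y, hy, rfl⟩ := hTφ x hxT (by rw [hxa, hx₁.2])
    refine ⟨y, ⟨hy, fun hsurj => hxK.1.2 fun w => ?_⟩, rfl⟩
    have hxU := hKU hxK
    have hφd := (hφ.contDiffAt (hV.mem_nhds hy)).differentiableAt (by simp)
    have hf₂d := (hf₂.contDiffAt (hU.mem_nhds hxU)).differentiableAt (by simp)
    have hf₁d := (hf₁.contDiffAt (hU.mem_nhds hxU)).differentiableAt (by simp)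
    rw [fderiv_comp _ hf₂d hφd] at hsurj
    have htan : (fderiv ℝ f₁ (φ y)).comp (fderiv ℝ φ y) = 0 := by
      rw [← fderiv_comp _ hf₁d hφd]
      have : f₁ ∘ φ =ᶠ[𝓝 y] fun _ => f₁ x₁ :=
        Filter.eventually_of_mem (hV.mem_nhds hy) hφh
      rw [this.fderiv_eq, fderiv_fun_const]; rfl
    obtain ⟨u, hu⟩ : ∃ u, fderiv ℝ f₁ (φ y) u = w 0 := by
      obtain ⟨u, hu⟩ : ∃ u, fderiv ℝ f₁ (φ y) u ≠ 0 := by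
        by_contra! H
        exact ha ⟨φ y, ⟨hxU, ContinuousLinearMap.ext H⟩, hxa⟩
      exact ⟨(w 0 / fderiv ℝ f₁ (φ y) u) • u, by rw [map_smul, smul_eq_mul, div_mul_cancel₀ _ hu]⟩
    obtain ⟨z, hz⟩ := hsurj (fun i => w i.succ - fderiv ℝ f₂ (φ y) u i)
    refine ⟨u + fderiv ℝ φ y z, funext fun i => ?_⟩
    refine Fin.cases ?_ (fun i => ?_) i
    · rw [← hd₁ _ hxU, map_add, hu]
      have : fderiv ℝ f₁ (φ y) (fderiv ℝ φ y z) = 0 :=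
        congrArg (fun A : _ →L[ℝ] ℝ => A z) htan
      rw [this, add_zero]
    · rw [← hd₂ _ hxU, map_add, Pi.add_apply]
      have : fderiv ℝ f₂ (φ y) (fderiv ℝ φ y z) i = w i.succ - fderiv ℝ f₂ (φ y) u i :=
        congrFun hz i
      rw [this]; ring

/-- **Sard's theorem**: the set of critical values of a smooth map between finite-dimensional
spaces is null. -/
theorem addHaar_image_not_surjective_eq_zero {E F : Type*} [NormedAddCommGroup E]
    [NormedSpace ℝ E] [FiniteDimensional ℝ E] [NormedAddCommGroup F] [NormedSpace ℝ F]
    [FiniteDimensional ℝ F] [MeasurableSpace F] [BorelSpace F] (μ : Measure F)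
    [μ.IsAddHaarMeasure] {U : Set E} (hU : IsOpen U) {f : E → F} (hf : ContDiffOn ℝ ∞ f U) :
    μ (f '' {x ∈ U | ¬ Function.Surjective (fderiv ℝ f x)}) = 0 := by
  let L : F ≃L[ℝ] (Fin (Module.finrank ℝ F) → ℝ) :=
    ContinuousLinearEquiv.ofFinrankEq (by simp)
  have hμ : μ = (μ.map L).map L.symm := by
    rw [Measure.map_map L.symm.continuous.measurable L.continuous.measurable]
    simp
  have h0 := volume_image_not_surjective_eq_zero _ hU (L.contDiff.comp_contDiffOn hf)
  have h1 : μ.map L (L '' (f '' {x ∈ U | ¬ Function.Surjective (fderiv ℝ f x)})) = 0 := by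
    refine Measure.absolutelyContinuous_isAddHaarMeasure _ volume ?_
    rw [← Set.image_comp]
    refine measure_mono_null (Set.image_mono ?_) h0
    intro x hx
    refine ⟨hx.1, fun hs => hx.2 ?_⟩
    rw [fderiv_comp _ L.differentiableAt
      ((hf.contDiffAt (hU.mem_nhds hx.1)).differentiableAt (by simp)), L.fderiv] at hs
    intro y
    obtain ⟨v, hv⟩ := hs (L y)
    exact ⟨v, L.injective hv⟩
  have hLe : (L : F → _) = L.toHomeomorph.toMeasurableEquiv := rfl
  rw [hLe, MeasurableEquiv.map_apply, ← hLe, Set.preimage_image_eq _ L.injective] at h1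
  exact h1

/-! ### Transversality to the rank stratification of a space of linear maps -/

section RankStratification

variable {E V W R K C : Type*}
  [NormedAddCommGroup E] [NormedSpace ℝ E] [NormedAddCommGroup V] [NormedSpace ℝ V]
  [NormedAddCommGroup W] [NormedSpace ℝ W]
  [NormedAddCommGroup R] [NormedSpace ℝ R] [NormedAddCommGroup K] [NormedSpace ℝ K]
  [NormedAddCommGroup C] [NormedSpace ℝ C]

/-- The image of `D`, together with the maps `B ∘ A + A ∘ C`, spans all linear maps `V → W`. The
maps `B ∘ A + A ∘ C` form the tangent space at `A` of the maps of the same rank as `A`, so for a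
family of linear maps with value `A` and derivative `D` at a point this is transversality to the
maps of that rank. -/
def TransverseToRank (A : V →L[ℝ] W) (D : E →L[ℝ] V →L[ℝ] W) : Prop :=
  ∀ T : V →L[ℝ] W, ∃ (v : E) (B : W →L[ℝ] W) (C : V →L[ℝ] V), T = D v + B.comp A + A.comp C

/-- Transversality to the maps of the rank of `A` needs at least as many parameters as the
codimension `dim (ker A) * dim (coker A)` of this set. -/
theorem TransverseToRank.mul_le_finrank [FiniteDimensional ℝ E] [FiniteDimensional ℝ V]
    [FiniteDimensional ℝ W] {A : V →L[ℝ] W} {D : E →L[ℝ] V →L[ℝ] W} (h : TransverseToRank A D) :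
    (Module.finrank ℝ V - Module.finrank ℝ A.range) *
      (Module.finrank ℝ W - Module.finrank ℝ A.range) ≤ Module.finrank ℝ E := by
  let Φ : E →ₗ[ℝ] (A.ker →ₗ[ℝ] W ⧸ A.range) :=
    { toFun := fun v => A.range.mkQ ∘ₗ (D v : V →ₗ[ℝ] W) ∘ₗ A.ker.subtype
      map_add' := fun v w => by ext; simp
      map_smul' := fun s v => by ext; simp }
  have hΦ : Function.Surjective Φ := by
    intro T
    obtain ⟨q, hq⟩ := A.range.mkQ.exists_rightInverse_of_surjective A.range.range_mkQ
    obtain ⟨k, hk⟩ := A.ker.subtype.exists_leftInverse_of_injective A.ker.ker_subtype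
    obtain ⟨v, B, C, hT⟩ := h (q ∘ₗ T ∘ₗ k).toContinuousLinearMap
    refine ⟨v, LinearMap.ext fun x => ?_⟩
    have h1 := congrArg (fun L : V →L[ℝ] W => A.range.mkQ (L x)) hT
    have hx : A (x : V) = 0 := x.2
    have h2 : A.range.mkQ (A (C x)) = 0 := (Submodule.Quotient.mk_eq_zero _).2 ⟨C x, rfl⟩
    have h3 : k (x : V) = x := congrArg (fun L : A.ker →ₗ[ℝ] A.ker => L x) hk
    have h4 : ∀ z, A.range.mkQ (q z) = z := fun z =>
      congrArg (fun L : (W ⧸ A.range) →ₗ[ℝ] (W ⧸ A.range) => L z) hq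
    simp only [add_apply, ContinuousLinearMap.comp_apply, hx, map_add, map_zero,
      add_zero, h2, LinearMap.coe_toContinuousLinearMap', LinearMap.comp_apply, h3, h4] at h1
    exact h1.symm
  have h1 := LinearMap.finrank_le_finrank_of_surjective hΦ
  rw [Module.finrank_linearMap, Submodule.finrank_quotient] at h1
  have h2 := (A : V →ₗ[ℝ] W).finrank_range_add_finrank_ker
  rwa [show Module.finrank ℝ V - Module.finrank ℝ A.range = Module.finrank ℝ A.ker by
    have : Module.finrank ℝ A.range = Module.finrank ℝ (A : V →ₗ[ℝ] W).range := rfl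
    have : Module.finrank ℝ A.ker = Module.finrank ℝ (A : V →ₗ[ℝ] W).ker := rfl
    omega]

variable (V W R K C) in
/-- Decompositions `V = R ⊕ K` and `W = R ⊕ C`, that is, a partition of the linear maps `V → W`
into four blocks with a square upper left one. -/
structure BlockSplitting where
  inl : R →L[ℝ] V
  inr : K →L[ℝ] V
  fst : V →L[ℝ] R
  snd : V →L[ℝ] K
  outl : R →L[ℝ] W
  outr : C →L[ℝ] W
  prl : W →L[ℝ] R
  prr : W →L[ℝ] C
  inl_fst_add : ∀ v, inl (fst v) + inr (snd v) = v
  snd_inr : ∀ k, snd (inr k) = k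
  outl_prl_add : ∀ w, outl (prl w) + outr (prr w) = w
  prl_outr : ∀ z, prl (outr z) = 0
  prr_outr : ∀ z, prr (outr z) = z

namespace BlockSplitting

/-- A linear map splits `V` as `range A ⊕ ker A` and `W` as the range of `A` plus a complement. -/
theorem exists_of_clm [FiniteDimensional ℝ V] [FiniteDimensional ℝ W] (A : V →L[ℝ] W) :
    ∃ (C : Submodule ℝ W) (s : BlockSplitting V W A.range A.ker C),
      (∀ r, s.prl (A (s.inl r)) = r) ∧ ∀ k, A (s.inr k) = 0 := by
  obtain ⟨p, hp⟩ := Submodule.ClosedComplemented.of_finiteDimensional A.range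
  obtain ⟨κ, hκ⟩ := Submodule.ClosedComplemented.of_finiteDimensional A.ker
  let lam : V →L[ℝ] A.range := A.codRestrict A.range fun v => ⟨v, rfl⟩
  have hlam : ∀ v, (lam v : W) = A v := fun v => rfl
  obtain ⟨g, hg⟩ := (lam : V →ₗ[ℝ] A.range).exists_rightInverse_of_surjective
    (LinearMap.range_eq_top.2 fun ⟨w, v, hv⟩ => ⟨v, Subtype.ext hv⟩)
  have hlg : ∀ r, lam (g r) = r := fun r =>
    congrArg (fun L : A.range →ₗ[ℝ] A.range => L r) hg
  have hAk : ∀ k : A.ker, A k = 0 := fun k => k.2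
  let ι : A.range →L[ℝ] V :=
    g.toContinuousLinearMap - A.ker.subtypeL.comp (κ.comp g.toContinuousLinearMap)
  have hι : ∀ r, ι r = g r - (κ (g r) : V) := fun r => rfl
  have hAι : ∀ r, A (ι r) = r := by
    intro r
    rw [hι, map_sub, hAk, sub_zero, ← hlam, hlg]
  have hκι : ∀ r, κ (ι r) = 0 := fun r => by rw [hι, map_sub, hκ, sub_self]
  let c : W →L[ℝ] (p : W →L[ℝ] A.range).ker :=
    (ContinuousLinearMap.id ℝ W - A.range.subtypeL.comp p).codRestrict _ fun w => by
      change p (w - (p w : W)) = 0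
      rw [map_sub, hp, sub_self]
  have hc : ∀ w, (c w : W) = w - p w := fun w => rfl
  refine ⟨p.ker, ⟨ι, A.ker.subtypeL, lam, κ, A.range.subtypeL, p.ker.subtypeL, p, c,
    fun v => ?_, fun k => hκ k, fun w => ?_, fun z => z.2, fun z => ?_⟩, fun r => ?_,
    fun k => k.2⟩
  · have hmem : v - ι (lam v) ∈ A.ker := by
      change A (v - ι (lam v)) = 0
      rw [map_sub, hAι, hlam, sub_self]
    have h1 : κ v = ⟨v - ι (lam v), hmem⟩ := by
      rw [← hκ ⟨v - ι (lam v), hmem⟩, map_sub, hκι, sub_zero]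
    change ι (lam v) + (κ v : V) = v
    rw [h1]
    exact add_sub_cancel _ _
  · change (p w : W) + (c w : W) = w
    rw [hc]; abel
  · apply Subtype.ext
    have hz : p (z : W) = 0 := z.2
    change (c (z : W) : W) = z
    rw [hc, hz]; simp
  · change p (A (ι r)) = r
    rw [hAι, hp]

variable (s : BlockSplitting V W R K C)

/-- The upper left block of a linear map. -/
def corner (A : V →L[ℝ] W) : R →L[ℝ] R := s.prl.comp (A.comp s.inl)

/-- The column operation that clears the upper right block of `A`, if the corner is invertible.
When `A` has the rank of its corner, this parametrizes the kernel of `A`. -/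
noncomputable def clearCol (A : V →L[ℝ] W) : K →L[ℝ] V :=
  s.inr - s.inl.comp ((Ring.inverse (s.corner A)).comp (s.prl.comp (A.comp s.inr)))

/-- The row operation that clears the lower left block of `A`, if the corner is invertible.
When `A` has the rank of its corner, this is a projection to the cokernel of `A`. -/
noncomputable def clearRow (A : V →L[ℝ] W) : W →L[ℝ] C :=
  s.prr - s.prr.comp (A.comp (s.inl.comp ((Ring.inverse (s.corner A)).comp s.prl)))

/-- The Schur complement of the corner; its vanishing characterizes the maps that have the rank of
their corner. -/
noncomputable def schur (A : V →L[ℝ] W) : K →L[ℝ] C := s.prr.comp (A.comp (s.clearCol A))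

variable {s} {A : V →L[ℝ] W}

theorem corner_inverse (h : IsUnit (s.corner A)) (r : R) :
    s.prl (A (s.inl (Ring.inverse (s.corner A) r))) = r :=
  congrArg (fun L : R →L[ℝ] R => L r) (Ring.mul_inverse_cancel _ h)

theorem inverse_corner (h : IsUnit (s.corner A)) (r : R) :
    Ring.inverse (s.corner A) (s.prl (A (s.inl r))) = r :=
  congrArg (fun L : R →L[ℝ] R => L r) (Ring.inverse_mul_cancel _ h)

theorem clearCol_apply (k : K) : s.clearCol A k =
    s.inr k - s.inl (Ring.inverse (s.corner A) (s.prl (A (s.inr k)))) := rfl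

theorem clearRow_apply (w : W) : s.clearRow A w =
    s.prr w - s.prr (A (s.inl (Ring.inverse (s.corner A) (s.prl w)))) := rfl

theorem prl_clearCol (h : IsUnit (s.corner A)) (k : K) : s.prl (A (s.clearCol A k)) = 0 := by
  rw [clearCol_apply, map_sub, map_sub, corner_inverse h, sub_self]

/-- If `A` has the rank of its invertible corner, then the first block column already spans the
range of `A`, and so the cleared second one vanishes. -/
theorem schur_eq_zero_of_finrank_eq [FiniteDimensional ℝ V] [FiniteDimensional ℝ W]
    (h : IsUnit (s.corner A)) (hr : Module.finrank ℝ A.range = Module.finrank ℝ R) :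
    s.schur A = 0 := by
  have hle : (A.comp s.inl).range ≤ A.range := by
    rintro _ ⟨r, rfl⟩
    exact ⟨s.inl r, rfl⟩
  have hinj : Function.Injective (A.comp s.inl) := by
    intro r r' hrr
    have : A (s.inl r) = A (s.inl r') := hrr
    rw [← inverse_corner h r, this, inverse_corner h r']
  have heq : (A.comp s.inl).range = A.range := by
    refine Submodule.eq_of_le_of_finrank_eq hle ?_
    rw [hr]
    exact LinearMap.finrank_range_of_inj hinj
  ext k
  obtain ⟨r, hr'⟩ : A (s.clearCol A k) ∈ (A.comp s.inl).range := heq ▸ ⟨_, rfl⟩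
  have hr' : A (s.inl r) = A (s.clearCol A k) := hr'
  have h0 : r = 0 := by
    rw [← inverse_corner h r, hr', prl_clearCol h, map_zero]
  change s.prr (A (s.clearCol A k)) = 0
  rw [← hr', h0, map_zero, map_zero, map_zero]

/-- A map that sends the kernel of `A` into its range has the form `B ∘ A + A ∘ C`. -/
theorem exists_eq_comp_add_comp (h : IsUnit (s.corner A))
    {T : V →L[ℝ] W} (hT : ∀ k, s.clearRow A (T (s.clearCol A k)) = 0) :
    ∃ (B : W →L[ℝ] W) (C : V →L[ℝ] V), T = B.comp A + A.comp C := by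
  let b := Ring.inverse (s.corner A)
  refine ⟨T.comp (s.inl.comp (b.comp s.prl)),
    s.inl.comp (b.comp (s.prl.comp (T.comp ((s.clearCol A).comp s.snd)))), ?_⟩
  ext v
  change T v = T (s.inl (b (s.prl (A v)))) +
    A (s.inl (b (s.prl (T (s.clearCol A (s.snd v))))))
  have h1 : v = s.inl (b (s.prl (A v))) + s.clearCol A (s.snd v) := by
    conv_rhs => rw [clearCol_apply, ← s.inl_fst_add v]
    simp only [map_add, s.snd_inr, b, inverse_corner h]
    conv_lhs => rw [← s.inl_fst_add v]
    have h2 : s.snd (s.inl (s.fst v)) = 0 := by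
      have := congrArg s.snd (s.inl_fst_add v)
      rwa [map_add, s.snd_inr, add_eq_right] at this
    simp only [h2, map_zero]
    abel
  have h2 : ∀ w, s.clearRow A w = 0 → w = A (s.inl (b (s.prl w))) := by
    intro w hw
    rw [clearRow_apply, sub_eq_zero] at hw
    have h3 := s.outl_prl_add (A (s.inl (Ring.inverse (s.corner A) (s.prl w))))
    rwa [corner_inverse h, ← hw, s.outl_prl_add] at h3
  rw [← h2 _ (hT _), ← map_add, ← h1]

/-- The derivative of the Schur complement, `D` being the derivative of the linear map. -/
noncomputable def schurDeriv (s : BlockSplitting V W R K C) (A : V →L[ℝ] W)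
    (D : E →L[ℝ] V →L[ℝ] W) : E →L[ℝ] K →L[ℝ] C :=
  ((ContinuousLinearMap.compL ℝ K W C (s.clearRow A)).comp
    ((ContinuousLinearMap.compL ℝ K V W).flip (s.clearCol A))).comp D

theorem schurDeriv_apply (D : E →L[ℝ] V →L[ℝ] W) (v : E) (k : K) :
    s.schurDeriv A D v k = s.clearRow A (D v (s.clearCol A k)) := rfl

theorem transverseToRank_of_surjective_schurDeriv (h : IsUnit (s.corner A))
    {D : E →L[ℝ] V →L[ℝ] W} (hD : Function.Surjective (s.schurDeriv A D)) :
    TransverseToRank A D := by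
  intro T
  obtain ⟨v, hv⟩ := hD ((s.clearRow A).comp (T.comp (s.clearCol A)))
  obtain ⟨B, C, hBC⟩ := exists_eq_comp_add_comp h (T := T - D v) fun k => by
    have h1 := congrArg (fun L : K →L[ℝ] C => L k) hv
    rw [sub_apply, map_sub, sub_eq_zero]
    exact h1.symm
  exact ⟨v, B, C, by rw [add_assoc, ← hBC]; abel⟩

theorem contDiffAt_inverse_corner [CompleteSpace R] {M : E → V →L[ℝ] W} {x : E}
    (hM : ContDiffAt ℝ ∞ M x) (h : IsUnit (s.corner (M x))) :
    ContDiffAt ℝ ∞ (fun z => Ring.inverse (s.corner (M z))) x := by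
  obtain ⟨u, hu⟩ := h
  have h1 : ContDiffAt ℝ ∞ Ring.inverse (s.corner (M x)) := hu ▸ contDiffAt_ringInverse ℝ u
  exact h1.comp x (contDiffAt_const.clm_comp (hM.clm_comp contDiffAt_const))

theorem contDiffAt_clearCol [CompleteSpace R] {M : E → V →L[ℝ] W} {x : E}
    (hM : ContDiffAt ℝ ∞ M x) (h : IsUnit (s.corner (M x))) :
    ContDiffAt ℝ ∞ (fun z => s.clearCol (M z)) x :=
  contDiffAt_const.sub (contDiffAt_const.clm_comp ((contDiffAt_inverse_corner hM h).clm_comp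
    (contDiffAt_const.clm_comp (hM.clm_comp contDiffAt_const))))

theorem contDiffAt_clearRow [CompleteSpace R] {M : E → V →L[ℝ] W} {x : E}
    (hM : ContDiffAt ℝ ∞ M x) (h : IsUnit (s.corner (M x))) :
    ContDiffAt ℝ ∞ (fun z => s.clearRow (M z)) x :=
  contDiffAt_const.sub (contDiffAt_const.clm_comp (hM.clm_comp (contDiffAt_const.clm_comp
    ((contDiffAt_inverse_corner hM h).clm_comp contDiffAt_const))))

theorem contDiffAt_schur [CompleteSpace R] {M : E → V →L[ℝ] W} {x : E}
    (hM : ContDiffAt ℝ ∞ M x) (h : IsUnit (s.corner (M x))) :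
    ContDiffAt ℝ ∞ (fun z => s.schur (M z)) x :=
  contDiffAt_const.clm_comp (hM.clm_comp (contDiffAt_clearCol hM h))

/-- The derivative of the Schur complement has no terms from the derivative of the inverse corner:
these are annihilated by `clearRow`, because the upper right block is cleared identically. -/
theorem hasFDerivAt_schur [CompleteSpace R] {M : E → V →L[ℝ] W} {x : E}
    (hM : ContDiffAt ℝ ∞ M x) (h : IsUnit (s.corner (M x))) :
    HasFDerivAt (fun z => s.schur (M z)) (s.schurDeriv (M x) (fderiv ℝ M x)) x := by
  have hMd := (hM.differentiableAt (by simp)).hasFDerivAt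
  -- `N` is the factor of `clearCol` between `inl` and the rest.
  set N : E → K →L[ℝ] R := fun z =>
    (Ring.inverse (s.corner (M z))).comp (s.prl.comp ((M z).comp s.inr)) with hN
  have hNd : HasFDerivAt N (fderiv ℝ N x) x :=
    (((contDiffAt_inverse_corner hM h).clm_comp (contDiffAt_const.clm_comp
      (hM.clm_comp contDiffAt_const))).differentiableAt (by simp)).hasFDerivAt
  have hQd : HasFDerivAt (fun z => s.clearCol (M z))
      (-(ContinuousLinearMap.compL ℝ K R V s.inl).comp (fderiv ℝ N x)) x :=
    ((ContinuousLinearMap.compL ℝ K R V s.inl).hasFDerivAt.comp x hNd).const_sub s.inr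
  have hAQ := hMd.clm_comp hQd
  have hzero : ∀ v k, s.prl (fderiv ℝ M x v (s.clearCol (M x) k)) =
      s.prl (M x (s.inl (fderiv ℝ N x v k))) := by
    have h1 := (ContinuousLinearMap.compL ℝ K W R s.prl).hasFDerivAt.comp x hAQ
    have hopen : ∀ᶠ z in 𝓝 x, IsUnit (s.corner (M z)) :=
      (continuousAt_const.clm_comp (hM.continuousAt.clm_comp continuousAt_const)).eventually_mem
        (Units.isOpen.mem_nhds h)
    have h2 : (ContinuousLinearMap.compL ℝ K W R s.prl ∘ fun z => (M z).comp (s.clearCol (M z)))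
        =ᶠ[𝓝 x] fun _ => 0 := by
      filter_upwards [hopen] with z hz
      ext k
      exact prl_clearCol hz k
    have h3 := h1.unique ((hasFDerivAt_const (0 : K →L[ℝ] R) x).congr_of_eventuallyEq h2)
    intro v k
    have h4 := congrArg (fun L : E →L[ℝ] K →L[ℝ] R => L v k) h3
    simp only [ContinuousLinearMap.comp_apply, ContinuousLinearMap.compL_apply, add_apply,
      neg_apply, ContinuousLinearMap.flip_apply, map_add, map_neg, _root_.zero_apply] at h4
    exact (neg_add_eq_zero.1 h4).symm
  have hfin := (ContinuousLinearMap.compL ℝ K W C s.prr).hasFDerivAt.comp x hAQ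
  refine hfin.congr_fderiv ?_
  ext v k
  rw [schurDeriv_apply, clearRow_apply, hzero, inverse_corner h]
  simp only [ContinuousLinearMap.comp_apply, ContinuousLinearMap.compL_apply, add_apply,
    neg_apply, ContinuousLinearMap.flip_apply, map_add, map_neg]
  exact neg_add_eq_sub _ _

end BlockSplitting

end RankStratification

/-! ### Generic transversality of linearly perturbed families -/

section Generic

variable {E V W R K C : Type*}
  [NormedAddCommGroup E] [NormedSpace ℝ E] [NormedAddCommGroup V] [NormedSpace ℝ V]
  [NormedAddCommGroup W] [NormedSpace ℝ W]
  [NormedAddCommGroup R] [NormedSpace ℝ R] [NormedAddCommGroup K] [NormedSpace ℝ K]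
  [NormedAddCommGroup C] [NormedSpace ℝ C]

namespace BlockSplitting

variable (s : BlockSplitting V W R K C) (A : V →L[ℝ] W)

theorem corner_add_outr_comp (B : V →L[ℝ] C) : s.corner (A + s.outr.comp B) = s.corner A := by
  ext r
  change s.prl (A (s.inl r) + s.outr (B (s.inl r))) = s.prl (A (s.inl r))
  rw [map_add, s.prl_outr, add_zero]

theorem clearCol_add_outr_comp (B : V →L[ℝ] C) :
    s.clearCol (A + s.outr.comp B) = s.clearCol A := by
  ext k
  rw [clearCol_apply, clearCol_apply, corner_add_outr_comp]
  change s.inr k - s.inl (Ring.inverse (s.corner A)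
    (s.prl (A (s.inr k) + s.outr (B (s.inr k))))) = _
  rw [map_add s.prl, s.prl_outr, add_zero]

theorem schur_add_outr_comp (B : V →L[ℝ] C) :
    s.schur (A + s.outr.comp B) = s.schur A + B.comp (s.clearCol A) := by
  ext k
  change s.prr ((A + s.outr.comp B) (s.clearCol (A + s.outr.comp B) k)) =
    s.prr (A (s.clearCol A k)) + B (s.clearCol A k)
  rw [clearCol_add_outr_comp]
  change s.prr (A (s.clearCol A k) + s.outr (B (s.clearCol A k))) = _
  rw [map_add, s.prr_outr]

end BlockSplitting

variable [FiniteDimensional ℝ E] [FiniteDimensional ℝ R] [FiniteDimensional ℝ K]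
  [FiniteDimensional ℝ C]

/-- Along the perturbations `M + outr ∘ τ ∘ σ` of a family `M` of linear maps, the Schur complement
is, up to the invertible factor `σ ∘ clearCol M`, the difference of `τ` and a map `Ψ` that does
not depend on `τ`. So almost every `τ` is a regular value of `Ψ`, by Sard's theorem, and for these
`τ` the Schur complement of the perturbed family has zero as a regular value. -/
theorem BlockSplitting.addHaar_schur_not_regular [MeasurableSpace (K →L[ℝ] C)]
    [BorelSpace (K →L[ℝ] C)]
    (ν : Measure (K →L[ℝ] C)) [ν.IsAddHaarMeasure] (s : BlockSplitting V W R K C) {Ω : Set E}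
    (hΩ : IsOpen Ω) {M : E → V →L[ℝ] W} (hM : ContDiffOn ℝ ∞ M Ω) {σ : E → V →L[ℝ] K}
    (hσ : ContDiffOn ℝ ∞ σ Ω) :
    ν {τ | ∃ x ∈ Ω, IsUnit (s.corner (M x)) ∧ IsUnit ((σ x).comp (s.clearCol (M x))) ∧
      s.schur (M x + s.outr.comp (τ.comp (σ x))) = 0 ∧
      ¬ Function.Surjective (s.schurDeriv (M x + s.outr.comp (τ.comp (σ x)))
        (fderiv ℝ (fun z => M z + s.outr.comp (τ.comp (σ z))) x))} = 0 := by
  have : CompleteSpace R := FiniteDimensional.complete ℝ R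
  have : CompleteSpace K := FiniteDimensional.complete ℝ K
  set G : E → K →L[ℝ] K := fun x => (σ x).comp (s.clearCol (M x)) with hG
  set Ψ : E → K →L[ℝ] C := fun x => -(s.schur (M x)).comp (Ring.inverse (G x)) with hΨ
  have hc1 : ContinuousOn (fun x => s.corner (M x)) Ω :=
    continuousOn_const.clm_comp (hM.continuousOn.clm_comp continuousOn_const)
  set O₁ := Ω ∩ (fun x => s.corner (M x)) ⁻¹' {u | IsUnit u} with hO₁
  have hO₁o : IsOpen O₁ := hc1.isOpen_inter_preimage hΩ Units.isOpen
  have hGs : ContDiffOn ℝ ∞ G O₁ := fun x hx =>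
    ((hσ.contDiffAt (hΩ.mem_nhds hx.1)).clm_comp
      (contDiffAt_clearCol (hM.contDiffAt (hΩ.mem_nhds hx.1)) hx.2)).contDiffWithinAt
  set O := O₁ ∩ G ⁻¹' {u | IsUnit u} with hO
  have hOo : IsOpen O := hGs.continuousOn.isOpen_inter_preimage hO₁o Units.isOpen
  have hΨs : ContDiffOn ℝ ∞ Ψ O := by
    intro x hx
    obtain ⟨u, hu⟩ := hx.2
    have h1 : ContDiffAt ℝ ∞ Ring.inverse (G x) := hu ▸ contDiffAt_ringInverse ℝ u
    exact ((contDiffAt_schur (hM.contDiffAt (hΩ.mem_nhds hx.1.1)) hx.1.2).clm_comp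
      (h1.comp x (hGs.contDiffAt (hO₁o.mem_nhds hx.1)))).neg.contDiffWithinAt
  refine measure_mono_null ?_ (addHaar_image_not_surjective_eq_zero ν hOo hΨs)
  rintro τ ⟨x, hx, hxu, hxG, hx0, hxs⟩
  have hxO : x ∈ O := ⟨⟨hx, hxu⟩, hxG⟩
  have hid : ∀ z ∈ O, s.schur (M z + s.outr.comp (τ.comp (σ z))) = (τ - Ψ z).comp (G z) := by
    intro z hz
    rw [schur_add_outr_comp]
    ext k
    have h1 : Ring.inverse (G z) (G z k) = k :=
      congrArg (fun L : K →L[ℝ] K => L k) (Ring.inverse_mul_cancel _ hz.2)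
    change s.schur (M z) k + τ (G z k) =
      τ (G z k) - -(s.schur (M z) (Ring.inverse (G z) (G z k)))
    rw [h1]; abel
  -- As `G x` is invertible, `x` lies over the parameter `τ` exactly if `Ψ x = τ`.
  have hτ : τ - Ψ x = 0 := by
    have h1 := hid x hxO
    rw [hx0] at h1
    have h2 : ((τ - Ψ x).comp (G x)).comp (Ring.inverse (G x)) = τ - Ψ x := by
      ext k
      have h1 : G x (Ring.inverse (G x) k) = k :=
        congrArg (fun L : K →L[ℝ] K => L k) (Ring.mul_inverse_cancel _ hxG)
      change (τ - Ψ x) (G x (Ring.inverse (G x) k)) = _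
      rw [h1]
    rw [← h2, ← h1, ContinuousLinearMap.zero_comp]
  refine ⟨x, ⟨hxO, fun hsurj => hxs ?_⟩, (sub_eq_zero.1 hτ).symm⟩
  have hMx := hM.contDiffAt (hΩ.mem_nhds hx)
  have hσx := hσ.contDiffAt (hΩ.mem_nhds hx)
  have hd1 := hasFDerivAt_schur (s := s) (M := fun z => M z + s.outr.comp (τ.comp (σ z)))
    (hMx.add (contDiffAt_const.clm_comp (contDiffAt_const.clm_comp hσx)))
    (by rw [corner_add_outr_comp]; exact hxu)
  have hΨd : HasFDerivAt (fun z => τ - Ψ z) (-fderiv ℝ Ψ x) x :=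
    ((hΨs.contDiffAt (hOo.mem_nhds hxO)).differentiableAt (by simp)).hasFDerivAt.const_sub τ
  have hGd := ((hGs.contDiffAt (hO₁o.mem_nhds hxO.1)).differentiableAt (by simp)).hasFDerivAt
  have hd2 := hΨd.clm_comp hGd
  have heq := hd1.unique (hd2.congr_of_eventuallyEq
    (Filter.eventually_of_mem (hOo.mem_nhds hxO) hid))
  intro T
  obtain ⟨v, hv⟩ := hsurj (-T.comp (Ring.inverse (G x)))
  refine ⟨v, ?_⟩
  rw [heq]
  ext k
  have h1 : Ring.inverse (G x) (G x k) = k :=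
    congrArg (fun L : K →L[ℝ] K => L k) (Ring.inverse_mul_cancel _ hxG)
  rw [hτ]
  simp only [map_zero, ContinuousLinearMap.zero_comp, zero_add, ContinuousLinearMap.comp_apply,
    neg_apply, ContinuousLinearMap.flip_apply, ContinuousLinearMap.compL_apply, hv, neg_neg, h1]

end Generic

section Perturbation

variable {E V W X : Type*}
  [NormedAddCommGroup E] [NormedSpace ℝ E] [NormedAddCommGroup V] [NormedSpace ℝ V]
  [NormedAddCommGroup W] [NormedSpace ℝ W] [NormedAddCommGroup X] [NormedSpace ℝ X]

theorem fderiv_add_clm_comp {P : E → V →L[ℝ] W} {H : E → V →L[ℝ] X} {x : E}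
    (hP : DifferentiableAt ℝ P x) (hH : DifferentiableAt ℝ H x) (π : X →L[ℝ] W) :
    fderiv ℝ (fun z => P z + π.comp (H z)) x =
      fderiv ℝ P x + (ContinuousLinearMap.compL ℝ V X W π).comp (fderiv ℝ H x) :=
  (hP.hasFDerivAt.add
    ((ContinuousLinearMap.compL ℝ V X W π).hasFDerivAt.comp x hH.hasFDerivAt)).fderiv

variable [FiniteDimensional ℝ E] [FiniteDimensional ℝ W] [FiniteDimensional ℝ X]

/-- A set of parameters `π` is null if, in each translate of the space of the maps
`outr ∘ τ ∘ ρ`, it consists of parameters for which zero is not a regular value of the Schur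
complement of `P + π ∘ H`. -/
theorem BlockSplitting.addHaar_eq_zero_of_schur_not_regular {R K C : Type*}
    [NormedAddCommGroup R] [NormedSpace ℝ R] [NormedAddCommGroup K] [NormedSpace ℝ K]
    [NormedAddCommGroup C] [NormedSpace ℝ C] [FiniteDimensional ℝ R] [FiniteDimensional ℝ K]
    [FiniteDimensional ℝ C] (μ : Measure (X →L[ℝ] W)) [μ.IsAddHaarMeasure]
    (s : BlockSplitting V W R K C) {Ω : Set E} (hΩ : IsOpen Ω) {P : E → V →L[ℝ] W}
    {H : E → V →L[ℝ] X} (hP : ContDiffOn ℝ ∞ P Ω) (hH : ContDiffOn ℝ ∞ H Ω) (ρ : X →L[ℝ] K)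
    {S : Set (X →L[ℝ] W)} (hS : MeasurableSet S)
    (h : ∀ π ∈ S, ∃ x ∈ Ω, IsUnit (s.corner (P x + π.comp (H x))) ∧
      IsUnit ((ρ.comp (H x)).comp (s.clearCol (P x + π.comp (H x)))) ∧
      s.schur (P x + π.comp (H x)) = 0 ∧
      ¬ Function.Surjective (s.schurDeriv (P x + π.comp (H x))
        (fderiv ℝ (fun z => P z + π.comp (H z)) x))) : μ S = 0 := by
  let Λ : (K →L[ℝ] C) →ₗ[ℝ] (X →L[ℝ] W) :=
    { toFun := fun τ => s.outr.comp (τ.comp ρ)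
      map_add' := fun a b => by ext; simp
      map_smul' := fun a b => by ext; simp }
  refine measure_eq_zero_iff_ae_notMem.2 (ae_mem_of_ae_add_linearMap_mem Λ
    (Measure.addHaar : Measure (K →L[ℝ] C)) μ hS.compl fun y =>
      measure_eq_zero_iff_ae_notMem.1 (measure_mono_null (fun τ hτ => ?_)
        (s.addHaar_schur_not_regular Measure.addHaar hΩ
          (hP.add (contDiffOn_const (c := y) |>.clm_comp hH))
          (contDiffOn_const (c := ρ) |>.clm_comp hH))))
  have hadd : ∀ z, P z + (y + Λ τ).comp (H z) =
      P z + y.comp (H z) + s.outr.comp (τ.comp (ρ.comp (H z))) := by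
    intro z
    ext v
    change P z v + (y (H z v) + s.outr (τ (ρ (H z v)))) =
      (P z v + y (H z v)) + s.outr (τ (ρ (H z v)))
    rw [add_assoc]
  obtain ⟨x, hx, h1, h2, h3, h4⟩ := h _ hτ
  simp only [hadd, corner_add_outr_comp, clearCol_add_outr_comp] at h1 h2 h3 h4
  exact ⟨x, hx, h1, h2, h3, h4⟩

variable [FiniteDimensional ℝ V]

/-- A point `x₀` and a parameter `π₀` have a neighbourhood in which the failures of transversality
to the maps of the rank occurring at `(x₀, π₀)` involve only a null set of parameters. -/
theorem exists_nhds_addHaar_not_transverseToRank (μ : Measure (X →L[ℝ] W)) [μ.IsAddHaarMeasure]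
    {Ω : Set E} (hΩ : IsOpen Ω) {P : E → V →L[ℝ] W} {H : E → V →L[ℝ] X}
    (hP : ContDiffOn ℝ ∞ P Ω) (hH : ContDiffOn ℝ ∞ H Ω) {x₀ : E} (hx₀ : x₀ ∈ Ω)
    (hinj : Function.Injective (H x₀)) (π₀ : X →L[ℝ] W) :
    ∃ T ∈ 𝓝 (x₀, π₀), μ (Prod.snd '' ({p : E × (X →L[ℝ] W) | p.1 ∈ Ω ∧
      Module.finrank ℝ (P p.1 + p.2.comp (H p.1)).range =
        Module.finrank ℝ (P x₀ + π₀.comp (H x₀)).range ∧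
      ¬ TransverseToRank (P p.1 + p.2.comp (H p.1))
        (fderiv ℝ (fun z => P z + p.2.comp (H z)) p.1)} ∩ T)) = 0 := by
  have : CompleteSpace V := FiniteDimensional.complete ℝ V
  have : CompleteSpace W := FiniteDimensional.complete ℝ W
  set A₀ := P x₀ + π₀.comp (H x₀) with hA₀
  obtain ⟨C, s, hs1, hs2⟩ := BlockSplitting.exists_of_clm A₀
  have : CompleteSpace A₀.range := FiniteDimensional.complete ℝ _
  have : CompleteSpace A₀.ker := FiniteDimensional.complete ℝ _
  obtain ⟨l, hl⟩ := (H x₀ : V →ₗ[ℝ] X).exists_leftInverse_of_injective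
    (LinearMap.ker_eq_bot.2 hinj)
  let ρ : X →L[ℝ] A₀.ker := s.snd.comp l.toContinuousLinearMap
  let M : E × (X →L[ℝ] W) → V →L[ℝ] W := fun p => P p.1 + p.2.comp (H p.1)
  let G : E × (X →L[ℝ] W) → A₀.ker →L[ℝ] A₀.ker := fun p =>
    (ρ.comp (H p.1)).comp (s.clearCol (M p))
  let D : E × (X →L[ℝ] W) → E →L[ℝ] V →L[ℝ] W := fun p =>
    fderiv ℝ (fun z => P z + p.2.comp (H z)) p.1
  have hPx : ∀ x ∈ Ω, ContDiffAt ℝ ∞ P x := fun x hx => hP.contDiffAt (hΩ.mem_nhds hx)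
  have hHx : ∀ x ∈ Ω, ContDiffAt ℝ ∞ H x := fun x hx => hH.contDiffAt (hΩ.mem_nhds hx)
  have hM : ∀ p : E × (X →L[ℝ] W), p.1 ∈ Ω → ContDiffAt ℝ ∞ M p := fun p hp =>
    ((hPx _ hp).comp p contDiffAt_fst).add
      (contDiffAt_snd.clm_comp ((hHx _ hp).comp p contDiffAt_fst))
  have hcorner : ∀ p : E × (X →L[ℝ] W), p.1 ∈ Ω → ContinuousAt (fun q => s.corner (M q)) p :=
    fun p hp => continuousAt_const.clm_comp ((hM p hp).continuousAt.clm_comp continuousAt_const)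
  have hcol : ∀ p : E × (X →L[ℝ] W), p.1 ∈ Ω → IsUnit (s.corner (M p)) →
      ContinuousAt (fun q => s.clearCol (M q)) p := fun p hp hu =>
    (BlockSplitting.contDiffAt_clearCol (hM p hp) hu).continuousAt
  have hrow : ∀ p : E × (X →L[ℝ] W), p.1 ∈ Ω → IsUnit (s.corner (M p)) →
      ContinuousAt (fun q => s.clearRow (M q)) p := fun p hp hu =>
    (BlockSplitting.contDiffAt_clearRow (hM p hp) hu).continuousAt
  have hG : ∀ p : E × (X →L[ℝ] W), p.1 ∈ Ω → IsUnit (s.corner (M p)) → ContinuousAt G p :=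
    fun p hp hu => (continuousAt_const.clm_comp
      ((hHx _ hp).comp p contDiffAt_fst).continuousAt).clm_comp (hcol p hp hu)
  have hD : ∀ p : E × (X →L[ℝ] W), p.1 ∈ Ω → ContinuousAt D p := by
    intro p hp
    have h1 : D =ᶠ[𝓝 p] fun q => fderiv ℝ P q.1 +
        (ContinuousLinearMap.compL ℝ V X W q.2).comp (fderiv ℝ H q.1) := by
      filter_upwards [continuousAt_fst.eventually_mem (hΩ.mem_nhds hp)] with q hq
      exact fderiv_add_clm_comp ((hPx _ hq).differentiableAt (by simp))
        ((hHx _ hq).differentiableAt (by simp)) q.2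
    refine ContinuousAt.congr ?_ h1.symm
    have h2 : ContinuousAt (fderiv ℝ P) p.1 :=
      ((hPx _ hp).fderiv_right (m := 0) (by simp)).continuousAt
    have h3 : ContinuousAt (fderiv ℝ H) p.1 :=
      ((hHx _ hp).fderiv_right (m := 0) (by simp)).continuousAt
    exact (h2.comp continuousAt_fst).add
      (((ContinuousLinearMap.compL ℝ V X W).continuous.continuousAt.comp continuousAt_snd).clm_comp
        (h3.comp continuousAt_fst))
  have hu₀ : s.corner A₀ = 1 := ContinuousLinearMap.ext hs1
  have hG₀ : G (x₀, π₀) = 1 := by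
    ext1 k
    change s.snd (l (H x₀ (s.clearCol A₀ k))) = k
    have h1 : s.clearCol A₀ k = s.inr k := by
      rw [BlockSplitting.clearCol_apply, hs2, map_zero, map_zero, map_zero, sub_zero]
    have h2 : l (H x₀ (s.inr k)) = s.inr k :=
      congrArg (fun L : V →ₗ[ℝ] V => L (s.inr k)) hl
    rw [h1, h2, s.snd_inr]
  have hnear : ∀ᶠ p in 𝓝 (x₀, π₀), p.1 ∈ Ω ∧ IsUnit (s.corner (M p)) ∧ IsUnit (G p) := by
    have hu : IsUnit (s.corner (M (x₀, π₀))) := by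
      change IsUnit (s.corner A₀)
      rw [hu₀]; exact isUnit_one
    have huG : IsUnit (G (x₀, π₀)) := by rw [hG₀]; exact isUnit_one
    have hGnear : ∀ᶠ p in 𝓝 (x₀, π₀), IsUnit (G p) := by
      filter_upwards [hG (x₀, π₀) hx₀ hu
        ((Units.isOpen (R := A₀.ker →L[ℝ] A₀.ker)).mem_nhds huG)] with p hp
      exact hp
    exact (continuousAt_fst.eventually_mem (hΩ.mem_nhds hx₀)).and
      (((hcorner (x₀, π₀) hx₀).eventually_mem (Units.isOpen.mem_nhds hu)).and hGnear)
  obtain ⟨r, hr, hball⟩ := Metric.nhds_basis_closedBall.mem_iff.1 hnear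
  -- On a compact ball the set of failures is compact, so that its projection is measurable.
  set T := Metric.closedBall (x₀, π₀) r with hT
  refine ⟨T, Metric.closedBall_mem_nhds _ hr, ?_⟩
  set Q : Set (E × (X →L[ℝ] W)) := T ∩ (fun p => (s.schur (M p), s.schurDeriv (M p) (D p))) ⁻¹'
    ({0} ×ˢ {L : E →L[ℝ] A₀.ker →L[ℝ] C | Function.Surjective L}ᶜ) with hQ
  have hcl : IsClosed {L : E →L[ℝ] A₀.ker →L[ℝ] C | Function.Surjective L}ᶜ :=
    (isOpen_setOf_surjective_clm (E := E) (F := A₀.ker →L[ℝ] C)).isClosed_compl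
  have hQc : IsCompact Q := by
    refine (isCompact_closedBall (x₀, π₀) r).of_isClosed_subset ?_ Set.inter_subset_left
    refine ContinuousOn.preimage_isClosed_of_isClosed
      (fun p hp => ContinuousAt.continuousWithinAt ?_) Metric.isClosed_closedBall
      (isClosed_singleton.prod hcl)
    obtain ⟨hpΩ, hpu, -⟩ := hball hp
    refine (BlockSplitting.contDiffAt_schur (hM p hpΩ) hpu).continuousAt.prodMk ?_
    exact (((ContinuousLinearMap.compL ℝ A₀.ker W C).continuous.continuousAt.comp
      (hrow p hpΩ hpu)).clm_comp
      ((ContinuousLinearMap.compL ℝ A₀.ker V W).flip.continuous.continuousAt.comp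
      (hcol p hpΩ hpu))).clm_comp (hD p hpΩ)
  have hmeas : MeasurableSet (Prod.snd '' Q) := (hQc.image continuous_snd).measurableSet
  refine measure_mono_null (Set.image_mono ?_ : _ ⊆ Prod.snd '' Q) ?_
  · rintro p ⟨⟨hpΩ, hprank, hpt⟩, hpT⟩
    obtain ⟨-, hpu, -⟩ := hball hpT
    exact ⟨hpT, BlockSplitting.schur_eq_zero_of_finrank_eq hpu hprank,
      fun hsurj => hpt (BlockSplitting.transverseToRank_of_surjective_schurDeriv hpu hsurj)⟩
  · refine s.addHaar_eq_zero_of_schur_not_regular μ hΩ hP hH ρ hmeas ?_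
    rintro _ ⟨⟨x, π⟩, ⟨hpT, hp0, hps⟩, rfl⟩
    obtain ⟨hpΩ, hpu, hpG⟩ := hball hpT
    exact ⟨x, hpΩ, hpu, hpG, hp0, hps⟩

/-- Adding `π ∘ H` with `H` pointwise injective makes a family of linear maps transverse to all
the sets of maps of constant rank, for almost every `π`. -/
theorem ae_transverseToRank (μ : Measure (X →L[ℝ] W)) [μ.IsAddHaarMeasure]
    {Ω : Set E} (hΩ : IsOpen Ω) {P : E → V →L[ℝ] W} {H : E → V →L[ℝ] X}
    (hP : ContDiffOn ℝ ∞ P Ω) (hH : ContDiffOn ℝ ∞ H Ω)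
    (hinj : ∀ x ∈ Ω, Function.Injective (H x)) :
    ∀ᵐ π ∂μ, ∀ x ∈ Ω, TransverseToRank (P x + π.comp (H x))
      (fderiv ℝ (fun z => P z + π.comp (H z)) x) := by
  have h : ∀ r : ℕ, μ (Prod.snd '' {p : E × (X →L[ℝ] W) | p.1 ∈ Ω ∧
      Module.finrank ℝ (P p.1 + p.2.comp (H p.1)).range = r ∧
      ¬ TransverseToRank (P p.1 + p.2.comp (H p.1))
        (fderiv ℝ (fun z => P z + p.2.comp (H z)) p.1)}) = 0 := by
    intro r
    refine measure_image_null_of_locally ?_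
    rintro ⟨x, π⟩ ⟨hx, rfl, -⟩
    exact exists_nhds_addHaar_not_transverseToRank μ hΩ hP hH hx (hinj x hx) π
  filter_upwards [ae_all_iff.2 fun r => measure_eq_zero_iff_ae_notMem.1 (h r)] with π hπ x hx
  by_contra hnot
  exact hπ _ ⟨(x, π), ⟨hx, rfl, hnot⟩, rfl⟩

end Perturbation

/-! ### The jet bundle in charts -/

section JetBundle

variable {n ℓ : ℕ}  {N : Type*} [TopologicalSpace N]
  [ChartedSpace (EuclideanSpace ℝ (Fin n)) N] [IsManifold (𝓡 n) ∞ N]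

theorem trivializationAt_jetBundle_apply (q : N) (p : JetBundle (n := n) ℓ N) :
    trivializationAt (JetModel n ℓ) (JetFibre (n := n) ℓ N) q p =
      (p.proj, p.snd.1, p.snd.2.comp
        ((trivializationAt (EuclideanSpace ℝ (Fin n)) (TangentSpace (𝓡 n)) q).symmL ℝ p.proj)) := by
  obtain ⟨q', y, A⟩ := p
  have h1 : (trivializationAt (EuclideanSpace ℝ (Fin n) →L[ℝ] EuclideanSpace ℝ (Fin ℓ))
      (fun x : N => TangentSpace (𝓡 n) x →L[ℝ] Bundle.Trivial N (EuclideanSpace ℝ (Fin ℓ)) x) q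
      ⟨q', A⟩).2 = A.comp
        ((trivializationAt (EuclideanSpace ℝ (Fin n)) (TangentSpace (𝓡 n)) q).symmL ℝ q') := by
    rw [hom_trivializationAt_apply]
    ext v
    simp [ContinuousLinearMap.inCoordinates]
  exact Prod.ext rfl (Prod.ext rfl h1)

theorem extChartAt_jetBundle_apply (p p' : JetBundle (n := n) ℓ N) :
    extChartAt (jetModelWithCorners n ℓ) p p' =
      (extChartAt (𝓡 n) p.proj p'.proj, p'.snd.1, p'.snd.2.comp
        ((trivializationAt (EuclideanSpace ℝ (Fin n)) (TangentSpace (𝓡 n)) p.proj).symmL ℝ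
          p'.proj)) := by
  rw [FiberBundle.extChartAt]
  exact congrArg (fun z => (extChartAt (𝓡 n) p.proj z.1, z.2))
    (trivializationAt_jetBundle_apply p.proj p')

/-- In the chart of the jet bundle over the chart `φ` of `N` at `q`, the 1-jet prolongation of `g`
is the 1-jet prolongation of `g ∘ φ⁻¹`. -/
theorem extChartAt_jetProlongation {g : N → EuclideanSpace ℝ (Fin ℓ)}
    (hg : ContMDiff (𝓡 n) (𝓡 ℓ) ∞ g) (p : JetBundle (n := n) ℓ N) {x : EuclideanSpace ℝ (Fin n)}
    (hx : x ∈ (extChartAt (𝓡 n) p.proj).target) :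
    extChartAt (jetModelWithCorners n ℓ) p
        (jetProlongation g ((extChartAt (𝓡 n) p.proj).symm x)) =
      (x, g ((extChartAt (𝓡 n) p.proj).symm x),
        fderiv ℝ (g ∘ (extChartAt (𝓡 n) p.proj).symm) x) := by
  have hsrc : (extChartAt (𝓡 n) p.proj).symm x ∈
      (chartAt (EuclideanSpace ℝ (Fin n)) p.proj).source := by
    simpa using (extChartAt (𝓡 n) p.proj).map_target hx
  have hr : extChartAt (𝓡 n) p.proj ((extChartAt (𝓡 n) p.proj).symm x) = x :=
    (extChartAt (𝓡 n) p.proj).right_inv hx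
  have h1 : ((trivializationAt (EuclideanSpace ℝ (Fin n)) (TangentSpace (𝓡 n)) p.proj).symmL ℝ
      ((extChartAt (𝓡 n) p.proj).symm x) : EuclideanSpace ℝ (Fin n) →L[ℝ] EuclideanSpace ℝ (Fin n))
      = (mfderiv 𝓘(ℝ, EuclideanSpace ℝ (Fin n)) (𝓡 n) (extChartAt (𝓡 n) p.proj).symm x :
        EuclideanSpace ℝ (Fin n) →L[ℝ] EuclideanSpace ℝ (Fin n)) := by
    have h2 := TangentBundle.symmL_trivializationAt (I := 𝓡 n) hsrc
    have h3 : ∀ y y', y = y' → (mfderiv 𝓘(ℝ, EuclideanSpace ℝ (Fin n)) (𝓡 n)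
        (extChartAt (𝓡 n) p.proj).symm y :
          EuclideanSpace ℝ (Fin n) →L[ℝ] EuclideanSpace ℝ (Fin n)) =
        (mfderiv 𝓘(ℝ, EuclideanSpace ℝ (Fin n)) (𝓡 n) (extChartAt (𝓡 n) p.proj).symm y' :
          EuclideanSpace ℝ (Fin n) →L[ℝ] EuclideanSpace ℝ (Fin n)) := by
      rintro y _ rfl
      rfl
    refine Eq.trans ?_
      (h3 (extChartAt (𝓡 n) p.proj ((extChartAt (𝓡 n) p.proj).symm x)) x hr)
    rw [ModelWithCorners.range_eq_univ, mfderivWithin_univ] at h2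
    exact h2
  have hsymm : MDifferentiableAt 𝓘(ℝ, EuclideanSpace ℝ (Fin n)) (𝓡 n)
      (extChartAt (𝓡 n) p.proj).symm x := by
    have := mdifferentiableWithinAt_extChartAt_symm (I := 𝓡 n) hx
    rwa [ModelWithCorners.range_eq_univ, mdifferentiableWithinAt_univ] at this
  have h4 : fderiv ℝ (g ∘ (extChartAt (𝓡 n) p.proj).symm) x =
      (mfderiv (𝓡 n) (𝓡 ℓ) g ((extChartAt (𝓡 n) p.proj).symm x) :
        EuclideanSpace ℝ (Fin n) →L[ℝ] EuclideanSpace ℝ (Fin ℓ)).comp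
      (mfderiv 𝓘(ℝ, EuclideanSpace ℝ (Fin n)) (𝓡 n) (extChartAt (𝓡 n) p.proj).symm x :
        EuclideanSpace ℝ (Fin n) →L[ℝ] EuclideanSpace ℝ (Fin n)) := by
    rw [← mfderiv_eq_fderiv]
    exact mfderiv_comp x ((hg _).mdifferentiableAt (by simp)) hsymm
  rw [extChartAt_jetBundle_apply]
  refine Prod.ext hr (Prod.ext rfl ?_)
  rw [h4]
  exact congrArg (fun L : EuclideanSpace ℝ (Fin n) →L[ℝ] EuclideanSpace ℝ (Fin n) =>
    (mfderiv (𝓡 n) (𝓡 ℓ) g ((extChartAt (𝓡 n) p.proj).symm x) :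
        EuclideanSpace ℝ (Fin n) →L[ℝ] EuclideanSpace ℝ (Fin ℓ)).comp L) h1

/-- The corank of a jet can be read off in the charts of the jet bundle. -/
theorem finrank_range_extChartAt_jetBundle {p p' : JetBundle (n := n) ℓ N}
    (h : p' ∈ (extChartAt (jetModelWithCorners n ℓ) p).source) :
    Module.finrank ℝ (extChartAt (jetModelWithCorners n ℓ) p p').2.2.range =
      Module.finrank ℝ
        (p'.snd.2 : TangentSpace (𝓡 n) p'.proj →L[ℝ] EuclideanSpace ℝ (Fin ℓ)).range := by
  rw [extChartAt_jetBundle_apply]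
  have hsrc : p'.proj ∈ (chartAt (EuclideanSpace ℝ (Fin n)) p.proj).source := by
    rw [FiberBundle.extChartAt] at h
    have h2 := h.2
    simp only [mfld_simps] at h2
    exact h2
  have hbase : p'.proj ∈ (trivializationAt (EuclideanSpace ℝ (Fin n))
    (TangentSpace (𝓡 n) : N → Type _) p.proj).baseSet := by simpa using hsrc
  have heq : ((p'.snd.2 : TangentSpace (𝓡 n) p'.proj →L[ℝ] EuclideanSpace ℝ (Fin ℓ)).comp
      ((trivializationAt (EuclideanSpace ℝ (Fin n)) (TangentSpace (𝓡 n)) p.proj).symmL ℝ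
        p'.proj)).range =
      (p'.snd.2 : TangentSpace (𝓡 n) p'.proj →L[ℝ] EuclideanSpace ℝ (Fin ℓ)).range := by
    refine le_antisymm ?_ ?_
    · rintro _ ⟨v, rfl⟩
      exact ⟨_, rfl⟩
    · rintro _ ⟨v, rfl⟩
      refine ⟨(trivializationAt (EuclideanSpace ℝ (Fin n)) (TangentSpace (𝓡 n))
        p.proj).continuousLinearMapAt ℝ p'.proj v, ?_⟩
      exact congrArg p'.snd.2 (Bundle.Trivialization.symmL_continuousLinearMapAt _ hbase v)
  exact congrArg (fun S : Submodule ℝ (EuclideanSpace ℝ (Fin ℓ)) => Module.finrank ℝ S) heq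

/-- Let `c` be a curve in the model space of the jet bundle, starting at the coordinates of a jet
`p`, along which the rank of the matrix part is constant. Then the velocity of `c` is the velocity
of a curve in the corank stratum of `p`. -/
theorem isVelocityIn_corankStratum {p : JetBundle (n := n) ℓ N} {k : ℕ}
    (hp : p ∈ corankStratum n ℓ N k) {c : ℝ → EuclideanSpace ℝ (Fin n) × JetModel n ℓ}
    (hc : ContDiff ℝ ∞ c) (hc0 : c 0 = extChartAt (jetModelWithCorners n ℓ) p p)
    (hrank : ∀ᶠ t in 𝓝 0, Module.finrank ℝ (c t).2.2.range = Module.finrank ℝ (c 0).2.2.range)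
    {w : EuclideanSpace ℝ (Fin n) × JetModel n ℓ} (hw : HasDerivAt c w 0) :
    IsVelocityIn (jetModelWithCorners n ℓ) (corankStratum n ℓ N k) p w := by
  set Φ := extChartAt (jetModelWithCorners n ℓ) p with hΦ
  have htgt : ∀ᶠ t in 𝓝 0, c t ∈ Φ.target := by
    refine hc.continuous.continuousAt.eventually_mem ?_
    rw [hc0]
    exact extChartAt_target_mem_nhds p
  have h0 : Φ.symm (c 0) = p := by rw [hc0, hΦ, extChartAt_to_inv]
  have hsmooth : ContMDiffAt 𝓘(ℝ, ℝ) (jetModelWithCorners n ℓ) ∞ (fun t => Φ.symm (c t)) 0 := by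
    have h1 : ContMDiffAt 𝓘(ℝ, EuclideanSpace ℝ (Fin n) × JetModel n ℓ)
        (jetModelWithCorners n ℓ) ∞ Φ.symm (c 0) :=
      (contMDiffOn_extChartAt_symm p).contMDiffAt (by
        rw [hc0]
        exact extChartAt_target_mem_nhds p)
    exact h1.comp 0 hc.contMDiff.contMDiffAt
  have hcorank : ∀ p' ∈ Φ.source, corank ℓ (q := p'.proj) p'.snd.2 =
      min n ℓ - Module.finrank ℝ (Φ p').2.2.range := by
    intro p' hp'
    rw [finrank_range_extChartAt_jetBundle hp']
    rfl
  refine ⟨fun t => Φ.symm (c t), h0, hsmooth, ?_, ?_⟩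
  · filter_upwards [htgt, hrank] with t ht hrt
    have h1 := hcorank (Φ.symm (c t)) (Φ.map_target ht)
    rw [Φ.right_inv ht, hrt, hc0, ← hcorank p (mem_extChartAt_source p)] at h1
    exact h1.trans hp
  · have hmf : HasMFDerivAt 𝓘(ℝ, ℝ) (jetModelWithCorners n ℓ) (fun t => Φ.symm (c t)) 0
        (ContinuousLinearMap.toSpanSingleton ℝ w) := by
      refine ⟨hsmooth.continuousAt, ?_⟩
      have h1 : HasFDerivAt c (ContinuousLinearMap.toSpanSingleton ℝ w) 0 := hw.hasFDerivAt
      have h2 : writtenInExtChartAt 𝓘(ℝ, ℝ) (jetModelWithCorners n ℓ) 0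
          (fun t => Φ.symm (c t)) =ᶠ[𝓝 0] c := by
        filter_upwards [htgt] with t ht
        simp only [writtenInExtChartAt, h0, Function.comp_apply, mfld_simps]
        exact Φ.right_inv ht
      exact (h1.congr_of_eventuallyEq h2).hasFDerivWithinAt
    rw [hmf.mfderiv]
    exact one_smul ℝ w

theorem finrank_range_comp_comp_of_isUnit {V W : Type*} [NormedAddCommGroup V] [NormedSpace ℝ V]
    [NormedAddCommGroup W] [NormedSpace ℝ W] (A : V →L[ℝ] W) {B : W →L[ℝ] W} {C : V →L[ℝ] V}
    (hB : IsUnit B) (hC : IsUnit C) :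
    Module.finrank ℝ (B.comp (A.comp C)).range = Module.finrank ℝ A.range := by
  obtain ⟨B, rfl⟩ := hB
  obtain ⟨C, rfl⟩ := hC
  have hBinj : Function.Injective ((B : W →L[ℝ] W) : W →ₗ[ℝ] W) :=
    Function.LeftInverse.injective (g := (↑B⁻¹ : W →L[ℝ] W)) fun w =>
      congrArg (fun L : W →L[ℝ] W => L w) B.inv_mul
  have heq : ((B : W →L[ℝ] W).comp (A.comp (C : V →L[ℝ] V))).range =
      A.range.map ((B : W →L[ℝ] W) : W →ₗ[ℝ] W) := by
    refine le_antisymm ?_ ?_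
    · rintro _ ⟨v, rfl⟩
      exact ⟨_, ⟨(C : V →L[ℝ] V) v, rfl⟩, rfl⟩
    · rintro _ ⟨_, ⟨v, rfl⟩, rfl⟩
      have h : (C : V →L[ℝ] V) ((↑C⁻¹ : V →L[ℝ] V) v) = v :=
        congrArg (fun L : V →L[ℝ] V => L v) C.mul_inv
      exact ⟨(↑C⁻¹ : V →L[ℝ] V) v, congrArg (fun u => (B : W →L[ℝ] W) (A u)) h⟩
  rw [heq]
  exact (Submodule.equivMapOfInjective _ hBinj _).finrank_eq.symm

theorem exists_curve_isUnit_hasDerivAt {V : Type*} [NormedAddCommGroup V] [NormedSpace ℝ V]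
    [CompleteSpace V] (B : V →L[ℝ] V) : ∃ b : ℝ → V →L[ℝ] V, ContDiff ℝ ∞ b ∧ b 0 = 1 ∧
      (∀ᶠ t in 𝓝 0, IsUnit (b t)) ∧ HasDerivAt b B 0 := by
  have hb : ContDiff ℝ ∞ (fun t : ℝ => 1 + t • B) :=
    contDiff_const.add (contDiff_id.smul contDiff_const)
  have hb0 : 1 + (0 : ℝ) • B = 1 := by rw [zero_smul, add_zero]
  exact ⟨_, hb, hb0, hb.continuous.continuousAt.eventually_mem (s := {u | IsUnit u})
    (Units.isOpen.mem_nhds (by rw [hb0]; exact isUnit_one)),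
    (((hasDerivAt_id (0 : ℝ)).smul_const B).const_add 1).congr_deriv (one_smul ℝ B)⟩

/-- The tangent space of a corank stratum contains the directions that, in a chart, change the
linear part `A` of a jet by maps of the form `B ∘ A + A ∘ C`. -/
theorem mem_submanifoldTangentSpace_corankStratum {p : JetBundle (n := n) ℓ N} {k : ℕ}
    (hp : p ∈ corankStratum n ℓ N k) {A : EuclideanSpace ℝ (Fin n) →L[ℝ] EuclideanSpace ℝ (Fin ℓ)}
    (hA : (extChartAt (jetModelWithCorners n ℓ) p p).2.2 = A) (ξ : EuclideanSpace ℝ (Fin n))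
    (η : EuclideanSpace ℝ (Fin ℓ)) (B : EuclideanSpace ℝ (Fin ℓ) →L[ℝ] EuclideanSpace ℝ (Fin ℓ))
    (C : EuclideanSpace ℝ (Fin n) →L[ℝ] EuclideanSpace ℝ (Fin n)) :
    ((ξ, η, B.comp A + A.comp C) : EuclideanSpace ℝ (Fin n) × JetModel n ℓ) ∈
      submanifoldTangentSpace (jetModelWithCorners n ℓ) (corankStratum n ℓ N k) p := by
  refine Submodule.subset_span ?_
  obtain ⟨b, hb, hb0, hbu, hb'⟩ := exists_curve_isUnit_hasDerivAt B
  obtain ⟨d, hd, hd0, hdu, hd'⟩ := exists_curve_isUnit_hasDerivAt C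
  refine isVelocityIn_corankStratum (c := fun t =>
    ((extChartAt (jetModelWithCorners n ℓ) p p).1 + t • ξ,
      (extChartAt (jetModelWithCorners n ℓ) p p).2.1 + t • η, (b t).comp (A.comp (d t)))) hp
    ?_ ?_ ?_ ?_
  · exact (contDiff_const.add (contDiff_id.smul contDiff_const)).prodMk
      ((contDiff_const.add (contDiff_id.smul contDiff_const)).prodMk
        (hb.clm_comp (contDiff_const.clm_comp hd)))
  · refine Prod.ext ?_ (Prod.ext ?_ ?_)
    · simp
    · simp
    · rw [hA]
      ext v
      simp [hb0, hd0]
  · filter_upwards [hbu, hdu] with t htb htd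
    rw [finrank_range_comp_comp_of_isUnit A htb htd, finrank_range_comp_comp_of_isUnit A
      (hb0 ▸ isUnit_one) (hd0 ▸ isUnit_one)]
  · have h1 : HasDerivAt (fun t : ℝ => (extChartAt (jetModelWithCorners n ℓ) p p).1 + t • ξ) ξ 0 :=
      (((hasDerivAt_id (0 : ℝ)).smul_const ξ).const_add _).congr_deriv (one_smul ℝ ξ)
    have h2 : HasDerivAt
        (fun t : ℝ => (extChartAt (jetModelWithCorners n ℓ) p p).2.1 + t • η) η 0 :=
      (((hasDerivAt_id (0 : ℝ)).smul_const η).const_add _).congr_deriv (one_smul ℝ η)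
    have h3 : HasDerivAt (fun t => (b t).comp (A.comp (d t))) (B.comp A + A.comp C) 0 := by
      have := hb'.clm_comp ((hasDerivAt_const (0 : ℝ) A).clm_comp hd')
      refine this.congr_deriv ?_
      ext v
      simp [hb0, hd0]
    exact h1.prodMk (h2.prodMk h3)

/-- Transversality of a 1-jet prolongation to the corank strata, in a chart. -/
theorem transverseAt_jetProlongation {g : N → EuclideanSpace ℝ (Fin ℓ)}
    (hg : ContMDiff (𝓡 n) (𝓡 ℓ) ∞ g) (q : N)
    (h : TransverseToRank (fderiv ℝ (g ∘ (extChartAt (𝓡 n) q).symm) (extChartAt (𝓡 n) q q))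
      (fderiv ℝ (fderiv ℝ (g ∘ (extChartAt (𝓡 n) q).symm)) (extChartAt (𝓡 n) q q))) (k : ℕ) :
    TransverseAt (𝓡 n) (jetModelWithCorners n ℓ) (jetProlongation g) (corankStratum n ℓ N k) q := by
  rw [TransverseAt, or_iff_not_imp_left, not_not]
  intro hk
  set φ := extChartAt (𝓡 n) q with hφ
  set G := g ∘ φ.symm with hG
  set p : JetBundle (n := n) ℓ N := jetProlongation g q with hp
  have hjet : ∀ x ∈ φ.target, extChartAt (jetModelWithCorners n ℓ) p (jetProlongation g (φ.symm x))
      = (x, G x, fderiv ℝ G x) := fun x hx => extChartAt_jetProlongation hg p hx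
  have hx₀ : φ q ∈ φ.target := mem_extChartAt_target q
  have hGs : ContDiffOn ℝ ∞ G φ.target :=
    (hg.comp_contMDiffOn (contMDiffOn_extChartAt_symm q)).contDiffOn
  have hopen : IsOpen φ.target := isOpen_extChartAt_target q
  have hGa : ContDiffAt ℝ ∞ G (φ q) := hGs.contDiffAt (hopen.mem_nhds hx₀)
  have hG'a : ContDiffAt ℝ ∞ (fderiv ℝ G) (φ q) := hGa.fderiv_right (by simp)
  have hA : (extChartAt (jetModelWithCorners n ℓ) p p).2.2 = fderiv ℝ G (φ q) := by
    have h1 := hjet (φ q) hx₀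
    rw [hφ, extChartAt_to_inv] at h1
    exact congrArg (fun z => z.2.2) h1
  have hcont : ContinuousAt (jetProlongation g : N → JetBundle (n := n) ℓ N) q := by
    have hs : ContMDiffAt (𝓡 n) (jetModelWithCorners n ℓ) ∞
        (jetProlongation g : N → JetBundle (n := n) ℓ N) q := by
      refine Bundle.contMDiffAt_totalSpace.2 ⟨contMDiffAt_id, ?_⟩
      have h1 : ContMDiffAt (𝓡 n) 𝓘(ℝ, JetModel n ℓ) ∞
          (fun q' => (G (φ q'), fderiv ℝ G (φ q'))) q :=
        (hGa.prodMk hG'a).contMDiffAt.comp q contMDiffAt_extChartAt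
      refine h1.congr_of_eventuallyEq ?_
      filter_upwards [extChartAt_source_mem_nhds (I := 𝓡 n) q] with q' hq'
      have h2 := hjet (φ q') (φ.map_source hq')
      rw [φ.left_inv hq', FiberBundle.extChartAt] at h2
      exact congrArg Prod.snd h2
    exact hs.continuousAt
  have hd : HasMFDerivAt (𝓡 n) (jetModelWithCorners n ℓ)
      (jetProlongation g : N → JetBundle (n := n) ℓ N) q
      ((ContinuousLinearMap.id ℝ (EuclideanSpace ℝ (Fin n))).prod
        ((fderiv ℝ G (φ q)).prod (fderiv ℝ (fderiv ℝ G) (φ q)))) := by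
    refine ⟨hcont, HasFDerivAt.hasFDerivWithinAt ?_⟩
    have h1 : HasFDerivAt (fun x => (x, G x, fderiv ℝ G x))
        ((ContinuousLinearMap.id ℝ (EuclideanSpace ℝ (Fin n))).prod
        ((fderiv ℝ G (φ q)).prod (fderiv ℝ (fderiv ℝ G) (φ q)))) (φ q) :=
      (hasFDerivAt_id _).prodMk ((hGa.differentiableAt (by simp)).hasFDerivAt.prodMk
        (hG'a.differentiableAt (by simp)).hasFDerivAt)
    refine h1.congr_of_eventuallyEq ?_
    filter_upwards [hopen.mem_nhds hx₀] with x hx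
    exact hjet x hx
  rw [hd.mfderiv, eq_top_iff]
  rintro ⟨ξ, η, T⟩ -
  obtain ⟨v, B, C, hT⟩ := h T
  refine Submodule.mem_sup.2 ⟨(v, fderiv ℝ G (φ q) v, fderiv ℝ (fderiv ℝ G) (φ q) v), ⟨v, rfl⟩, _,
    mem_submanifoldTangentSpace_corankStratum hk hA (ξ - v) (η - fderiv ℝ G (φ q) v) B C, ?_⟩
  refine Prod.ext (add_sub_cancel _ _) (Prod.ext (add_sub_cancel _ _) ?_)
  rw [hT, add_assoc]
  rfl

end JetBundle

/-! ### Change of charts -/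

theorem fderiv_comp_eventuallyEq {V V' W : Type*} [NormedAddCommGroup V] [NormedSpace ℝ V]
    [NormedAddCommGroup V'] [NormedSpace ℝ V'] [NormedAddCommGroup W] [NormedSpace ℝ W]
    {G : V' → W} {θ : V → V'} {x : V} (hG : ContDiffAt ℝ ∞ G (θ x)) (hθ : ContDiffAt ℝ ∞ θ x) :
    fderiv ℝ (G ∘ θ) =ᶠ[𝓝 x] fun z => (fderiv ℝ G (θ z)).comp (fderiv ℝ θ z) := by
  have hGd : ∀ᶠ y in 𝓝 (θ x), ContDiffAt ℝ 1 G y := (hG.of_le (by simp)).eventually (by simp)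
  have hθd : ∀ᶠ z in 𝓝 x, ContDiffAt ℝ 1 θ z := (hθ.of_le (by simp)).eventually (by simp)
  filter_upwards [hθ.continuousAt.eventually hGd, hθd] with z h1 h2
  exact fderiv_comp z (h1.differentiableAt (by simp)) (h2.differentiableAt (by simp))

/-- Transversality of the differential of a map to the maps of constant rank does not depend on
the coordinates in the source: the second derivative of the coordinate change only contributes
a term of the form `A ∘ C`. -/
theorem TransverseToRank.comp_fderiv {V W : Type*} [NormedAddCommGroup V] [NormedSpace ℝ V]
    [NormedAddCommGroup W] [NormedSpace ℝ W] {G : V → W} {θ : V → V} {x : V}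
    (hG : ContDiffAt ℝ ∞ G (θ x)) (hθ : ContDiffAt ℝ ∞ θ x) {L : V →L[ℝ] V}
    (hL₁ : L.comp (fderiv ℝ θ x) = ContinuousLinearMap.id ℝ V)
    (hL₂ : (fderiv ℝ θ x).comp L = ContinuousLinearMap.id ℝ V)
    (h : TransverseToRank (fderiv ℝ G (θ x)) (fderiv ℝ (fderiv ℝ G) (θ x))) :
    TransverseToRank (fderiv ℝ (G ∘ θ) x) (fderiv ℝ (fderiv ℝ (G ∘ θ)) x) := by
  have heq := fderiv_comp_eventuallyEq hG hθ
  have hθd := (hθ.differentiableAt (by simp)).hasFDerivAt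
  have hG' : HasFDerivAt (fderiv ℝ G) (fderiv ℝ (fderiv ℝ G) (θ x)) (θ x) :=
    ((hG.fderiv_right (m := ∞) (by simp)).differentiableAt (by simp)).hasFDerivAt
  have hθ' : HasFDerivAt (fderiv ℝ θ) (fderiv ℝ (fderiv ℝ θ) x) x :=
    ((hθ.fderiv_right (m := ∞) (by simp)).differentiableAt (by simp)).hasFDerivAt
  have hd := (((hG'.comp x hθd).clm_comp hθ').congr_of_eventuallyEq heq).fderiv
  rw [heq.eq_of_nhds, hd]
  intro T
  obtain ⟨v, B, C, hT⟩ := h (T.comp L)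
  have h1 : ∀ u, L (fderiv ℝ θ x u) = u := fun u => congrArg (fun A : V →L[ℝ] V => A u) hL₁
  have h2 : ∀ u, fderiv ℝ θ x (L u) = u := fun u => congrArg (fun A : V →L[ℝ] V => A u) hL₂
  refine ⟨L v, B, L.comp (C.comp (fderiv ℝ θ x) - fderiv ℝ (fderiv ℝ θ) x (L v)), ?_⟩
  ext u
  have h3 := congrArg (fun A : V →L[ℝ] W => A (fderiv ℝ θ x u)) hT
  simp only [ContinuousLinearMap.comp_apply, add_apply, h1] at h3
  simp only [ContinuousLinearMap.comp_apply, add_apply, sub_apply, h2,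
    ContinuousLinearMap.compL_apply, ContinuousLinearMap.flip_apply, Function.comp_apply, h3,
    map_sub]
  abel

section Charts

variable {n ℓ m : ℕ} {N : Type*} [TopologicalSpace N]
  [ChartedSpace (EuclideanSpace ℝ (Fin n)) N]

theorem fderiv_comp_extChartAt_symm_eq_mfderiv {g : N → EuclideanSpace ℝ (Fin ℓ)}
    (hg : ContMDiff (𝓡 n) (𝓡 ℓ) ∞ g) (q : N) :
    fderiv ℝ (g ∘ (extChartAt (𝓡 n) q).symm) (extChartAt (𝓡 n) q q) =
      (mfderiv (𝓡 n) (𝓡 ℓ) g q : EuclideanSpace ℝ (Fin n) →L[ℝ] EuclideanSpace ℝ (Fin ℓ)) := by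
  have h := ((hg q).mdifferentiableAt (by simp)).mfderiv
  rw [h, ModelWithCorners.range_eq_univ, fderivWithin_univ]
  rfl

variable [IsManifold (𝓡 n) ∞ N]

theorem contDiffAt_transition {q₁ q₂ q : N} (h₁ : q ∈ (extChartAt (𝓡 n) q₁).source)
    (h₂ : q ∈ (extChartAt (𝓡 n) q₂).source) :
    ContDiffAt ℝ ∞ (extChartAt (𝓡 n) q₂ ∘ (extChartAt (𝓡 n) q₁).symm) (extChartAt (𝓡 n) q₁ q) := by
  have h := contDiffWithinAt_ext_coord_change (I := 𝓡 n) (n := ∞) q₂ q₁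
    (y := extChartAt (𝓡 n) q₁ q) (by
      rw [PartialEquiv.trans_source, PartialEquiv.symm_source]
      refine ⟨(extChartAt (𝓡 n) q₁).map_source h₁, ?_⟩
      rw [Set.mem_preimage, (extChartAt (𝓡 n) q₁).left_inv h₁]
      exact h₂)
  rwa [ModelWithCorners.range_eq_univ, contDiffWithinAt_univ] at h

theorem fderiv_transition_comp {q₁ q₂ q : N} (h₁ : q ∈ (extChartAt (𝓡 n) q₁).source)
    (h₂ : q ∈ (extChartAt (𝓡 n) q₂).source) :
    (fderiv ℝ (extChartAt (𝓡 n) q₁ ∘ (extChartAt (𝓡 n) q₂).symm) (extChartAt (𝓡 n) q₂ q)).comp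
      (fderiv ℝ (extChartAt (𝓡 n) q₂ ∘ (extChartAt (𝓡 n) q₁).symm) (extChartAt (𝓡 n) q₁ q)) =
      ContinuousLinearMap.id ℝ (EuclideanSpace ℝ (Fin n)) := by
  set φ₁ := extChartAt (𝓡 n) q₁ with hφ₁
  set φ₂ := extChartAt (𝓡 n) q₂ with hφ₂
  have hval : (φ₂ ∘ φ₁.symm) (φ₁ q) = φ₂ q := by
    rw [Function.comp_apply, φ₁.left_inv h₁]
  have hd₁ := (contDiffAt_transition h₁ h₂).differentiableAt (by simp)
  have hd₂ := (contDiffAt_transition h₂ h₁).differentiableAt (by simp)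
  rw [← hval] at hd₂ ⊢
  rw [← fderiv_comp _ hd₂ hd₁]
  have hopen : φ₁.target ∩ φ₁.symm ⁻¹' φ₂.source ∈ 𝓝 (φ₁ q) := by
    refine Filter.inter_mem ((isOpen_extChartAt_target q₁).mem_nhds (φ₁.map_source h₁)) ?_
    refine (continuousAt_extChartAt_symm' h₁).preimage_mem_nhds ?_
    rw [φ₁.left_inv h₁]
    exact (isOpen_extChartAt_source q₂).mem_nhds h₂
  have heq : (φ₁ ∘ φ₂.symm) ∘ (φ₂ ∘ φ₁.symm) =ᶠ[𝓝 (φ₁ q)] id := by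
    filter_upwards [hopen] with x hx
    change φ₁ (φ₂.symm (φ₂ (φ₁.symm x))) = x
    rw [φ₂.left_inv hx.2, φ₁.right_inv hx.1]
  rw [heq.fderiv_eq, fderiv_id]

theorem contDiffOn_comp_extChartAt_symm {g : N → EuclideanSpace ℝ (Fin ℓ)}
    (hg : ContMDiff (𝓡 n) (𝓡 ℓ) ∞ g) (q : N) :
    ContDiffOn ℝ ∞ (g ∘ (extChartAt (𝓡 n) q).symm) (extChartAt (𝓡 n) q).target :=
  (hg.comp_contMDiffOn (contMDiffOn_extChartAt_symm q)).contDiffOn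

/-- Transversality of the differential to the maps of constant rank does not depend on the chart. -/
theorem transverseToRank_of_mem_source {g : N → EuclideanSpace ℝ (Fin ℓ)}
    (hg : ContMDiff (𝓡 n) (𝓡 ℓ) ∞ g) {q q' : N} (hq : q ∈ (extChartAt (𝓡 n) q').source)
    (h : TransverseToRank (fderiv ℝ (g ∘ (extChartAt (𝓡 n) q').symm) (extChartAt (𝓡 n) q' q))
      (fderiv ℝ (fderiv ℝ (g ∘ (extChartAt (𝓡 n) q').symm)) (extChartAt (𝓡 n) q' q))) :
    TransverseToRank (fderiv ℝ (g ∘ (extChartAt (𝓡 n) q).symm) (extChartAt (𝓡 n) q q))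
      (fderiv ℝ (fderiv ℝ (g ∘ (extChartAt (𝓡 n) q).symm)) (extChartAt (𝓡 n) q q)) := by
  have hq₀ : q ∈ (extChartAt (𝓡 n) q).source := mem_extChartAt_source q
  set φ := extChartAt (𝓡 n) q with hφ
  set φ' := extChartAt (𝓡 n) q' with hφ'
  have hval : (φ' ∘ φ.symm) (φ q) = φ' q := by
    rw [Function.comp_apply, φ.left_inv hq₀]
  have hG : ContDiffAt ℝ ∞ (g ∘ φ'.symm) ((φ' ∘ φ.symm) (φ q)) := by
    rw [hval]
    exact (contDiffOn_comp_extChartAt_symm hg q').contDiffAt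
      ((isOpen_extChartAt_target q').mem_nhds (φ'.map_source hq))
  have hnhds : φ.symm ⁻¹' φ'.source ∈ 𝓝 (φ q) := by
    refine (continuousAt_extChartAt_symm' hq₀).preimage_mem_nhds ?_
    rw [φ.left_inv hq₀]
    exact (isOpen_extChartAt_source q').mem_nhds hq
  have heq : (g ∘ φ'.symm) ∘ (φ' ∘ φ.symm) =ᶠ[𝓝 (φ q)] g ∘ φ.symm := by
    filter_upwards [hnhds] with x hx
    change g (φ'.symm (φ' (φ.symm x))) = g (φ.symm x)
    rw [φ'.left_inv hx]
  rw [← hval] at h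
  have h1 := h.comp_fderiv hG (contDiffAt_transition hq₀ hq) (fderiv_transition_comp hq₀ hq)
    (fderiv_transition_comp hq hq₀)
  rwa [heq.fderiv_eq, heq.fderiv.fderiv_eq] at h1

theorem injective_fderiv_comp_extChartAt_symm {f : N → EuclideanSpace ℝ (Fin m)}
    (hf : ContMDiff (𝓡 n) (𝓡 m) ∞ f)
    (hf_imm : ∀ q, Function.Injective (mfderiv (𝓡 n) (𝓡 m) f q)) (q' : N)
    {x : EuclideanSpace ℝ (Fin n)} (hx : x ∈ (extChartAt (𝓡 n) q').target) :
    Function.Injective (fderiv ℝ (f ∘ (extChartAt (𝓡 n) q').symm) x) := by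
  set φ' := extChartAt (𝓡 n) q' with hφ'
  obtain ⟨q, hq, rfl⟩ : ∃ q ∈ φ'.source, φ' q = x := ⟨φ'.symm x, φ'.map_target hx, φ'.right_inv hx⟩
  have hq₀ : q ∈ (extChartAt (𝓡 n) q).source := mem_extChartAt_source q
  set φ := extChartAt (𝓡 n) q with hφ
  have hval : (φ ∘ φ'.symm) (φ' q) = φ q := by
    rw [Function.comp_apply, φ'.left_inv hq]
  have hG : ContDiffAt ℝ ∞ (f ∘ φ.symm) (φ q) :=
    (contDiffOn_comp_extChartAt_symm hf q).contDiffAt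
      ((isOpen_extChartAt_target q).mem_nhds (φ.map_source hq₀))
  have hnhds : φ'.symm ⁻¹' φ.source ∈ 𝓝 (φ' q) := by
    refine (continuousAt_extChartAt_symm' hq).preimage_mem_nhds ?_
    rw [φ'.left_inv hq]
    exact (isOpen_extChartAt_source q).mem_nhds hq₀
  have heq : (f ∘ φ.symm) ∘ (φ ∘ φ'.symm) =ᶠ[𝓝 (φ' q)] f ∘ φ'.symm := by
    filter_upwards [hnhds] with x hx
    change f (φ.symm (φ (φ'.symm x))) = f (φ'.symm x)
    rw [φ.left_inv hx]
  rw [← heq.fderiv_eq, fderiv_comp _ ((hval ▸ hG).differentiableAt (by simp))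
    ((contDiffAt_transition hq hq₀).differentiableAt (by simp)), hval,
    fderiv_comp_extChartAt_symm_eq_mfderiv hf]
  refine (hf_imm q).comp (Function.LeftInverse.injective
    (g := fderiv ℝ (φ' ∘ φ.symm) (φ q)) fun v => ?_)
  exact congrArg (fun L : EuclideanSpace ℝ (Fin n) →L[ℝ] EuclideanSpace ℝ (Fin n) => L v)
    (fderiv_transition_comp hq hq₀)

end Charts

/-! ### The null set of linear maps and the numerical bound -/

/-- The coordinates of a linear map `ℝᵐ → ℝ^ℓ`. -/
noncomputable def linearMapCoords (m ℓ : ℕ) :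
    (EuclideanSpace ℝ (Fin m) →L[ℝ] EuclideanSpace ℝ (Fin ℓ)) ≃L[ℝ] (Fin ℓ → Fin m → ℝ) :=
  (LinearEquiv.ofBijective
    ({ toFun := fun π i j => π (EuclideanSpace.single j 1) i
       map_add' := fun _ _ => rfl
       map_smul' := fun _ _ => rfl } :
      (EuclideanSpace ℝ (Fin m) →L[ℝ] EuclideanSpace ℝ (Fin ℓ)) →ₗ[ℝ] (Fin ℓ → Fin m → ℝ)) (by
    constructor
    · intro π π' h
      refine ContinuousLinearMap.coe_injective
        ((EuclideanSpace.basisFun (Fin m) ℝ).toBasis.ext fun j => ?_)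
      ext i
      have h1 : π (EuclideanSpace.single j 1) i = π' (EuclideanSpace.single j 1) i :=
        congrFun (congrFun h i) j
      simpa using h1
    · intro a
      refine ⟨((EuclideanSpace.basisFun (Fin m) ℝ).toBasis.constr ℝ
        (fun j => WithLp.toLp 2 fun i => a i j)).toContinuousLinearMap, ?_⟩
      ext i j
      have h := (EuclideanSpace.basisFun (Fin m) ℝ).toBasis.constr_basis ℝ
        (fun j => (WithLp.toLp 2 fun i => a i j : EuclideanSpace ℝ (Fin ℓ))) j
      have h2 := congrArg (fun v : EuclideanSpace ℝ (Fin ℓ) => v i) h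
      rw [OrthonormalBasis.coe_toBasis, EuclideanSpace.basisFun_apply] at h2
      exact h2)).toContinuousLinearEquiv

theorem hasLebesgueMeasureZero_of_ae {m ℓ : ℕ}
    {p : (EuclideanSpace ℝ (Fin m) →L[ℝ] EuclideanSpace ℝ (Fin ℓ)) → Prop}
    (h : ∀ (μ : Measure (EuclideanSpace ℝ (Fin m) →L[ℝ] EuclideanSpace ℝ (Fin ℓ)))
      [μ.IsAddHaarMeasure], ∀ᵐ π ∂μ, p π) : HasLebesgueMeasureZero {π | ¬ p π} := by
  let e := (linearMapCoords m ℓ).toHomeomorph.toMeasurableEquiv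
  have : (volume.map (linearMapCoords m ℓ).symm).IsAddHaarMeasure :=
    (linearMapCoords m ℓ).symm.isAddHaarMeasure_map volume
  have h1 := h (volume.map (linearMapCoords m ℓ).symm)
  have h2 : volume.map e.symm {π | ¬ p π} = 0 := h1
  rw [MeasurableEquiv.map_apply, ← MeasurableEquiv.image_eq_preimage_symm] at h2
  exact h2

/-- The bound `k₀` exists, because `k = 0` satisfies the inequality and every solution is at
most `n`. -/
theorem exists_isGreatest_corank (n ℓ : ℕ) (hn : 0 < n) : ∃ k₀ : ℤ,
    IsGreatest {k : ℤ | ((n : ℤ) - (min n ℓ : ℕ) + k) * ((ℓ : ℤ) - (min n ℓ : ℕ) + k) ≤ n} k₀ ∧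
      (2 ≤ ℓ → k₀ + 1 ≤ (min n ℓ : ℕ)) := by
  have h1 : (0 : ℤ) ≤ n - (min n ℓ : ℕ) := by omega
  have h2 : (0 : ℤ) ≤ ℓ - (min n ℓ : ℕ) := by omega
  have hprod : ((n : ℤ) - (min n ℓ : ℕ)) * (ℓ - (min n ℓ : ℕ)) = 0 := by
    rcases le_total n ℓ with h | h
    · rw [min_eq_left h, sub_self, zero_mul]
    · rw [min_eq_right h, sub_self, mul_zero]
  obtain ⟨k₀, hk₀, hmax⟩ := Int.exists_greatest_of_bdd
    (P := fun k : ℤ => ((n : ℤ) - (min n ℓ : ℕ) + k) * ((ℓ : ℤ) - (min n ℓ : ℕ) + k) ≤ n)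
    ⟨n, fun k hk => by
      by_contra! hlt
      nlinarith⟩ ⟨0, by rw [add_zero, add_zero, hprod]; positivity⟩
  refine ⟨k₀, ⟨hk₀, fun k hk => hmax k hk⟩, fun hℓ => ?_⟩
  by_contra! hlt
  have h3 : (n : ℤ) ≤ n - (min n ℓ : ℕ) + k₀ := by omega
  have h4 : (2 : ℤ) ≤ ℓ - (min n ℓ : ℕ) + k₀ := by omega
  nlinarith

theorem TransverseToRank.corank_le {n ℓ : ℕ} {N : Type*} [TopologicalSpace N]
    [ChartedSpace (EuclideanSpace ℝ (Fin n)) N] [IsManifold (𝓡 n) ∞ N] {k₀ : ℤ}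
    (hk₀ : IsGreatest
      {k : ℤ | ((n : ℤ) - (min n ℓ : ℕ) + k) * ((ℓ : ℤ) - (min n ℓ : ℕ) + k) ≤ n} k₀) (q : N)
    {A : EuclideanSpace ℝ (Fin n) →L[ℝ] EuclideanSpace ℝ (Fin ℓ)}
    {D : EuclideanSpace ℝ (Fin n) →L[ℝ] EuclideanSpace ℝ (Fin n) →L[ℝ] EuclideanSpace ℝ (Fin ℓ)}
    (h : TransverseToRank A D) : (corank ℓ (q := q) A : ℤ) ≤ k₀ := by
  refine hk₀.2 ?_
  have h1 := h.mul_le_finrank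
  have h2 : Module.finrank ℝ A.range ≤ n := by
    simpa using (A : EuclideanSpace ℝ (Fin n) →ₗ[ℝ] EuclideanSpace ℝ (Fin ℓ)).finrank_range_le
  have h3 : Module.finrank ℝ A.range ≤ ℓ := by simpa using A.range.finrank_le
  have h4 : corank ℓ (q := q) A = min n ℓ - Module.finrank ℝ A.range := rfl
  rw [finrank_euclideanSpace_fin, finrank_euclideanSpace_fin] at h1
  have h5 : (n : ℤ) - (min n ℓ : ℕ) + (corank ℓ (q := q) A : ℕ) =
      ((n - Module.finrank ℝ A.range : ℕ) : ℤ) := by omega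
  have h6 : (ℓ : ℤ) - (min n ℓ : ℕ) + (corank ℓ (q := q) A : ℕ) =
      ((ℓ - Module.finrank ℝ A.range : ℕ) : ℤ) := by omega
  change ((n : ℤ) - (min n ℓ : ℕ) + (corank ℓ (q := q) A : ℕ)) *
    ((ℓ : ℤ) - (min n ℓ : ℕ) + (corank ℓ (q := q) A : ℕ)) ≤ n
  rw [h5, h6]
  exact_mod_cast h1

/-! ### Almost every linear perturbation -/

theorem ae_transverseToRank_chart {n m ℓ : ℕ} {N : Type*} [TopologicalSpace N]
    [ChartedSpace (EuclideanSpace ℝ (Fin n)) N] [IsManifold (𝓡 n) ∞ N]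
    {f : N → EuclideanSpace ℝ (Fin m)} (hf : ContMDiff (𝓡 n) (𝓡 m) ∞ f)
    (hf_imm : ∀ q, Function.Injective (mfderiv (𝓡 n) (𝓡 m) f q))
    {g : N → EuclideanSpace ℝ (Fin ℓ)} (hg : ContMDiff (𝓡 n) (𝓡 ℓ) ∞ g)
    (μ : Measure (EuclideanSpace ℝ (Fin m) →L[ℝ] EuclideanSpace ℝ (Fin ℓ)))
    [μ.IsAddHaarMeasure] (q : N) :
    ∀ᵐ π ∂μ, ∀ x ∈ (extChartAt (𝓡 n) q).target,
      TransverseToRank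
        (fderiv ℝ ((fun q' => g q' + π (f q')) ∘ (extChartAt (𝓡 n) q).symm) x)
        (fderiv ℝ (fderiv ℝ ((fun q' => g q' + π (f q')) ∘ (extChartAt (𝓡 n) q).symm)) x) := by
  have hopen : IsOpen (extChartAt (𝓡 n) q).target := isOpen_extChartAt_target q
  have hfs := contDiffOn_comp_extChartAt_symm hf q
  have hgs := contDiffOn_comp_extChartAt_symm hg q
  filter_upwards [ae_transverseToRank μ hopen (hgs.fderiv_of_isOpen hopen (m := ∞) (by simp))
    (hfs.fderiv_of_isOpen hopen (m := ∞) (by simp))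
    fun x hx => injective_fderiv_comp_extChartAt_symm hf hf_imm q hx] with π hπ x hx
  have heq : ∀ y ∈ (extChartAt (𝓡 n) q).target,
      fderiv ℝ ((fun q' => g q' + π (f q')) ∘ (extChartAt (𝓡 n) q).symm) y =
      fderiv ℝ (g ∘ (extChartAt (𝓡 n) q).symm) y +
        π.comp (fderiv ℝ (f ∘ (extChartAt (𝓡 n) q).symm) y) := fun y hy =>
    ((((hgs.contDiffAt (hopen.mem_nhds hy)).differentiableAt (by simp)).hasFDerivAt).add
      (π.hasFDerivAt.comp y
        ((hfs.contDiffAt (hopen.mem_nhds hy)).differentiableAt (by simp)).hasFDerivAt)).fderiv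
  rw [heq x hx, Filter.EventuallyEq.fderiv_eq (Filter.eventually_of_mem (hopen.mem_nhds hx) heq)]
  exact hπ x hx

/-- For almost every `π`, the differential of `g + π ∘ f`, in the chart at each point, is transverse
to the maps of constant rank. -/
theorem ae_forall_transverseToRank {n m ℓ : ℕ} {N : Type*} [TopologicalSpace N]
    [SecondCountableTopology N]
    [ChartedSpace (EuclideanSpace ℝ (Fin n)) N] [IsManifold (𝓡 n) ∞ N]
    {f : N → EuclideanSpace ℝ (Fin m)} (hf : ContMDiff (𝓡 n) (𝓡 m) ∞ f)
    (hf_imm : ∀ q, Function.Injective (mfderiv (𝓡 n) (𝓡 m) f q))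
    {g : N → EuclideanSpace ℝ (Fin ℓ)} (hg : ContMDiff (𝓡 n) (𝓡 ℓ) ∞ g)
    (μ : Measure (EuclideanSpace ℝ (Fin m) →L[ℝ] EuclideanSpace ℝ (Fin ℓ)))
    [μ.IsAddHaarMeasure] :
    ∀ᵐ π ∂μ, ∀ q : N, TransverseToRank
      (fderiv ℝ ((fun q' => g q' + π (f q')) ∘ (extChartAt (𝓡 n) q).symm) (extChartAt (𝓡 n) q q))
      (fderiv ℝ (fderiv ℝ ((fun q' => g q' + π (f q')) ∘ (extChartAt (𝓡 n) q).symm))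
        (extChartAt (𝓡 n) q q)) := by
  obtain ⟨s, hsc, hs⟩ := TopologicalSpace.countable_cover_nhds
    fun q : N => extChartAt_source_mem_nhds (I := 𝓡 n) q
  have hae := (ae_ball_iff hsc).2 fun q' (_ : q' ∈ s) =>
    ae_transverseToRank_chart hf hf_imm hg μ q'
  filter_upwards [hae] with π hπ q
  obtain ⟨q', hq's, hq'⟩ := Set.mem_iUnion₂.1 (hs ▸ Set.mem_univ q)
  have hgπ : ContMDiff (𝓡 n) (𝓡 ℓ) ∞ (fun q => g q + π (f q)) :=
    hg.add (π.contDiff.contMDiff.comp hf)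
  exact transverseToRank_of_mem_source hgπ hq'
    (hπ q' hq's _ ((extChartAt (𝓡 n) q').map_source hq'))

theorem proposition5p1 (n m ℓ : ℕ) (hn : 0 < n) (hm : 0 < m) (hℓ : 0 < ℓ)
    {N : Type*} [TopologicalSpace N] [T2Space N] [SecondCountableTopology N]
    [ChartedSpace (EuclideanSpace ℝ (Fin n)) N] [IsManifold (𝓡 n) ∞ N]
    (U : Set (EuclideanSpace ℝ (Fin m))) (hU : IsOpen U)
    (f : N → EuclideanSpace ℝ (Fin m)) (hfU : ∀ q, f q ∈ U)
    (hf : ContMDiff (𝓡 n) (𝓡 m) ∞ f)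
    (hf_imm : ∀ q, Function.Injective (mfderiv (𝓡 n) (𝓡 m) f q))
    (F : EuclideanSpace ℝ (Fin m) → EuclideanSpace ℝ (Fin ℓ)) (hF : ContDiffOn ℝ ∞ F U) :
    ∃ k₀ : ℤ,
      IsGreatest {k : ℤ | ((n : ℤ) - (min n ℓ : ℕ) + k) * ((ℓ : ℤ) - (min n ℓ : ℕ) + k) ≤ n} k₀ ∧
      (2 ≤ ℓ → k₀ + 1 ≤ (min n ℓ : ℕ)) ∧
      ∃ S : Set (EuclideanSpace ℝ (Fin m) →L[ℝ] EuclideanSpace ℝ (Fin ℓ)),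
        HasLebesgueMeasureZero S ∧
        ∀ π ∉ S,
          (∀ k : ℕ, 1 ≤ k → k ≤ min n ℓ →
            Transverse (𝓡 n) (jetModelWithCorners n ℓ)
              (jetProlongation (fun q : N => F (f q) + π (f q))) (corankStratum n ℓ N k)) ∧
          (2 ≤ ℓ → ∀ k : ℕ, k₀ + 1 ≤ k → k ≤ min n ℓ →
            Set.range (jetProlongation (fun q : N => F (f q) + π (f q))) ∩
              corankStratum n ℓ N k = ∅) ∧
          (∀ q : N, (corank ℓ (mfderiv (𝓡 n) (𝓡 ℓ) (fun q : N => F (f q) + π (f q)) q) : ℤ) ≤ k₀) := by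
  obtain ⟨k₀, hk₀, hk₀v⟩ := exists_isGreatest_corank n ℓ hn
  have hFf : ContMDiff (𝓡 n) (𝓡 ℓ) ∞ (fun q => F (f q)) := fun q =>
    ((hF.contDiffAt (hU.mem_nhds (hfU q))).contMDiffAt).comp q (hf q)
  refine ⟨k₀, hk₀, hk₀v, _, hasLebesgueMeasureZero_of_ae fun μ _ =>
    ae_forall_transverseToRank hf hf_imm hFf μ, fun π hπ => ?_⟩
  have hgood := not_not.1 hπ
  have hg : ContMDiff (𝓡 n) (𝓡 ℓ) ∞ (fun q => F (f q) + π (f q)) :=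
    hFf.add (π.contDiff.contMDiff.comp hf)
  have hcorank : ∀ q : N,
      (corank ℓ (mfderiv (𝓡 n) (𝓡 ℓ) (fun q : N => F (f q) + π (f q)) q) : ℤ) ≤ k₀ := by
    intro q
    have h := (hgood q).corank_le hk₀ q
    rwa [fderiv_comp_extChartAt_symm_eq_mfderiv hg q] at h
  refine ⟨fun k _ _ q => transverseAt_jetProlongation hg q (hgood q) k, fun _ k hk _ => ?_, hcorank⟩
  rw [Set.eq_empty_iff_forall_notMem]
  rintro _ ⟨⟨q, rfl⟩, hq⟩
  have h1 : corank ℓ (mfderiv (𝓡 n) (𝓡 ℓ) (fun q : N => F (f q) + π (f q)) q) = k := hq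
  have h2 := hcorank q
  omega
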